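/- **Setting.** Let $\phi:\mathbb R^n\to\mathbb R$ be differentiable with $L$-Lipschitz gradient and $\beta$-strongly convex ($\beta>0$), i.e. $\phi(x)\ge\phi(y)+\nabla\phi(y)^T(x-y)+\frac\beta2\|x-y\|^2$ for all $x,y$, and let $\phi^*=\inf\phi$. *Zeroth-order oracle.* At a point $x$ it returns $f(x,\Xi)$, where the law of $\Xi$ may depend on $x$. With $e(x,\Xi)=|f(x,\Xi)-\phi(x)|$ it satisfies, for all $x$, $\mathbb E[e(x,\Xi)]\le\varepsilon_f$ and $\mathbb E[\exp\{\lambda(e(x,\Xi)-\mathbb E[e(x,\Xi)])\}]\le\exp(\lambda^2\nu^2/2)$ for all $\lambda\in[0,1/b]$, where $\varepsilon_f,\nu,b\ge0$ (and $[0,1/b]$ means $[0,\infty)$ if $b=0$). *First-order oracle.* At $x$ and $\alpha>0$ it returns $g(x,\alpha,\Xi')$, where the law of $\Xi'$ may depend on the query, with $\mathbb P(\|g(x,\alpha,\Xi')-\nabla\phi(x)\|\le\max\{\varepsilon_g,\min\{\tau,\kappa\alpha\}\|g(x,\alpha,\Xi')\|\})\ge1-\delta$, where $\varepsilon_g,\tau,\kappa\ge0$,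 $\delta\in[0,\frac12)$. *Algorithm (Q-SASS).* Input: $x_0$, $\alpha_0>0$, $\theta,\gamma\in(0,1)$, memory length $M$, inner product tolerance $\theta_{ip}$, spectral bounds $0<\sigma^B_{lb}\le\sigma^B_{ub}$, initial matrix $B_0=cI$ with $c\in[\sigma^B_{lb},\sigma^B_{ub}]$. The list of stored pairs is initially empty and $x_{prev},g_{prev}$ are unset. Iteration $k=0,1,2,\dots$: 1. Obtain $g_k=g(x_k,\alpha_k,\xi_k')$. 2. If $x_{prev}$ is set, put $s_k=x_k-x_{prev}$, $y_k=g_k-g_{prev}$; if $\langle s_k,y_k\rangle>\theta_{ip}$, append $(s_k,y_k)$ to the stored pairs, deleting first the oldest pair if $M$ pairs are stored; then (whether or not a pair was appended) delete stored pairs, oldest first, until all eigenvalues of the L-BFGS matrix built from $B_0$ and the stored pairs lie in $(\sigma^B_{lb},\sigma^B_{ub})$ or no pair is left. 3. With $B_k$ the L-BFGS matrix of the stored pairs ($B_k=B_0$ if there are none), let $d_k=B_k^{-1}g_k$ and $x_k^+=x_k-\alpha_kd_k$. 4. Obtain $f_k=f(x_k,\xi_k)$, $f_k^+=f(x_k^+,\xi_k^+)$.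 If $f_k^+\le f_k-\alpha_k\theta\langle d_k,g_k\rangle+2\varepsilon_f$, set $x_{prev}=x_k$, $g_{prev}=g_k$, $x_{k+1}=x_k^+$, $\alpha_{k+1}=\gamma^{-1}\alpha_k$; otherwise set $x_{k+1}=x_k$, $\alpha_{k+1}=\gamma\alpha_k$. Given the earlier iterations, $\xi'_k$ and $\xi_k$ follow the laws of the oracles at $(x_k,\alpha_k)$ and $x_k$, and given also $\xi_k'$, $\xi_k^+$ follows the law of the zeroth-order oracle at $x_k^+$. Write $X_k$ for the random iterates and $E_k,E_k^+$ for the random values of $e(x_k,\xi_k),e(x_k^+,\xi_k^+)$. Assume one of: * (bounded noise) $E_k,E_k^+\le\varepsilon_f$ almost surely for all $k$; then let $p=1-\delta$; * (independent noise) $E_0+E_0^+,E_1+E_1^+,\dots$ are mutually independent; then let $p=1-\delta-\exp(-\min\{\frac{u^2}{2\nu^2},\frac u{2b}\})$ with $u=\inf_x\{\varepsilon_f-\mathbb E[e(x,\Xi)]\}$ (where $v/0=\infty$ for $v>0$ and $0/0=0$). *Constants.* Let $\sigma_{lb}=1/\sigma^B_{ub}$, $\sigma_{ub}=1/\sigma^B_{lb}$,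 $K=\sigma_{lb}/\sigma_{ub}$, $\eta\in\left(0,\frac{1-\theta K}{1+(1-\theta)K}\right)$, $$\alpha_{\max}=\min\left\{\frac{2(1-\theta)\sigma_{lb}}{(2\kappa+L\sigma_{ub})\sigma_{ub}},\ \frac{2((1-\theta)(1-\eta)K-\eta)}{L\sigma_{ub}(1-\eta)}\right\},$$ $$h(\alpha)=\min\left\{-\ln\Big(1-\tfrac{\alpha\sigma_{lb}\theta\beta}{(1+\tau)^2}\Big),\ -\ln\big(1-\alpha\sigma_{lb}\beta\theta(1-\eta)^2\big)\right\}.$$ Assume $p>\frac12$ and the accuracy condition $$\varepsilon>\max\left\{\frac{\varepsilon_g^2}{2\beta\eta^2},\ \frac{4\varepsilon_f}{\left(1-\min\{\frac1{(1+\tau)^2},(1-\eta)^2\}\,\sigma_{lb}\theta\beta\,\alpha_{\max}\right)^{\frac12-p}-1},\ 4\varepsilon_f\right\}.$$ **Theorem (iteration complexity of Q-SASS for strongly convex functions).** Let $T_\varepsilon=\min\{k\ge0:\phi(X_k)-\phi^*\le\varepsilon\}$. Let $\bar\alpha\le\alpha_{\max}$ be a possible step size of the algorithm, i.e. $\bar\alpha=\alpha_0\gamma^i$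 for some $i\in\mathbb Z$. Let $s\ge0$ and $p_\ell=\frac12+\frac{\ln(1+4\varepsilon_f/\varepsilon)+s}{h(\bar\alpha)}$. Then for any $\hat p\in(p_\ell,p)$ and any number of iterations $t\in\mathbb N$ with $$t\ \ge\ \frac{\frac1{h(\bar\alpha)}\ln\left(\frac{\phi(x_0)-\phi^*}{\varepsilon}\right)+\left|\frac{\ln\alpha_0-\ln\bar\alpha}{2\ln\gamma}\right|}{\hat p-p_\ell}$$ (with the convention $\ln 0=0$, relevant only if $\phi(x_0)=\phi^*$, where $T_\varepsilon=0$) we have $$\mathbb P(T_\varepsilon\le t)\ \ge\ 1-\exp\left(-\frac{(p-\hat p)^2}{2p^2}t\right)-\exp\left(-\min\left\{\frac{s^2t}{2\nu_r^2},\frac{st}{2\nu_r}\right\}\right),\qquad \nu_r=4e^2\max\left\{\frac{2\nu}\varepsilon,\frac{2b}\varepsilon\right\}+4e\left(1+\frac{4\varepsilon_f}\varepsilon\right).$$ -/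

import Mathlib

open MeasureTheory ProbabilityTheory
open scoped ENNReal NNReal

noncomputable section

/-- `ℝⁿ` with the Euclidean norm. -/
abbrev Vec (n : ℕ) : Type := EuclideanSpace ℝ (Fin n)

/-! ### The L-BFGS matrix and its spectral safeguard -/

/-- One BFGS update, `B - (B s sᵀ B) / (sᵀ B s) + (y yᵀ) / (yᵀ s)`. -/
def bfgsUpdate {n : ℕ} (B : Matrix (Fin n) (Fin n) ℝ) (s y : Vec n) :
    Matrix (Fin n) (Fin n) ℝ :=
  B - (dotProduct s.ofLp (B.mulVec s.ofLp))⁻¹ •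
        Matrix.vecMulVec (B.mulVec s.ofLp) (Matrix.vecMul s.ofLp B)
    + (dotProduct y.ofLp s.ofLp)⁻¹ • Matrix.vecMulVec y.ofLp y.ofLp

/-- The L-BFGS matrix obtained from `B₀ = c I` and the stored pairs `(s, y)`, oldest pair first. -/
def lbfgsMatrix {n : ℕ} (c : ℝ) (mem : List (Vec n × Vec n)) : Matrix (Fin n) (Fin n) ℝ :=
  mem.foldl (fun B sy => bfgsUpdate B sy.1 sy.2) (c • (1 : Matrix (Fin n) (Fin n) ℝ))

open Classical in
/-- Remove stored pairs, oldest first, until all eigenvalues of the L-BFGS matrix lie strictly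
between `lb` and `ub` (or no pair is left). -/
def enforceSpectrum {n : ℕ} (c lb ub : ℝ) : List (Vec n × Vec n) → List (Vec n × Vec n)
  | [] => []
  | sy :: mem =>
      if ∀ μ ∈ spectrum ℝ (lbfgsMatrix c (sy :: mem)), lb < μ ∧ μ < ub then sy :: mem
      else enforceSpectrum c lb ub mem

/-! ### The Q-SASS algorithm -/

/-- The input of Q-SASS. -/
structure QSASSInput (n : ℕ) where
  /-- initial point -/
  x₀ : Vec n
  /-- initial step size -/
  α₀ : ℝ
  /-- sufficient decrease constant -/
  θ : ℝ
  /-- step size factor -/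
  γ : ℝ
  /-- the initial L-BFGS matrix is `c I` -/
  c : ℝ
  /-- memory length -/
  M : ℕ
  /-- lower bound for the spectrum of the L-BFGS matrices -/
  lbB : ℝ
  /-- upper bound for the spectrum of the L-BFGS matrices -/
  ubB : ℝ
  /-- inner product tolerance -/
  θip : ℝ
  /-- error tolerance -/
  εf : ℝ

/-- The admissible inputs. -/
structure QSASSInput.Admissible {n : ℕ} (I : QSASSInput n) : Prop where
  α₀_pos : 0 < I.α₀
  θ_mem : I.θ ∈ Set.Ioo (0 : ℝ) 1
  γ_mem : I.γ ∈ Set.Ioo (0 : ℝ) 1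
  lbB_pos : 0 < I.lbB
  c_mem : I.c ∈ Set.Icc I.lbB I.ubB

/-- `σ_lb = 1 / σ_ub^B`, the lower spectral bound for the inverse L-BFGS matrices. -/
def QSASSInput.σlb {n : ℕ} (I : QSASSInput n) : ℝ := I.ubB⁻¹

/-- `σ_ub = 1 / σ_lb^B`, the upper spectral bound for the inverse L-BFGS matrices. -/
def QSASSInput.σub {n : ℕ} (I : QSASSInput n) : ℝ := I.lbB⁻¹

/-- `K = σ_lb / σ_ub`. -/
def QSASSInput.K {n : ℕ} (I : QSASSInput n) : ℝ := I.σlb / I.σub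

/-- What Q-SASS carries from one iteration to the next. -/
structure QSASSState (n : ℕ) where
  /-- current iterate -/
  x : Vec n
  /-- current step size -/
  α : ℝ
  /-- stored pairs `(s, y)`, oldest first -/
  mem : List (Vec n × Vec n)
  /-- the pair `(x_prev, g_prev)`, if already set -/
  prev : Option (Vec n × Vec n)

namespace QSASSInput

variable {n : ℕ} (I : QSASSInput n)

/-- The state before the first iteration. -/
def init : QSASSState n := ⟨I.x₀, I.α₀, [], none⟩

/-- The stored pairs after the quasi-Newton update with the new gradient estimate `gk`. -/
def newMem (st : QSASSState n) (gk : Vec n) : List (Vec n × Vec n) :=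
  match st.prev with
  | none => st.mem
  | some (xprev, gprev) =>
      enforceSpectrum I.c I.lbB I.ubB
        (if I.θip < inner ℝ (st.x - xprev) (gk - gprev) then
          (if st.mem.length = I.M then st.mem.tail else st.mem) ++ [(st.x - xprev, gk - gprev)]
        else st.mem)

/-- The direction `d_k = B_k⁻¹ g_k`. -/
def dir (st : QSASSState n) (gk : Vec n) : Vec n :=
  WithLp.toLp 2 ((lbfgsMatrix I.c (I.newMem st gk))⁻¹.mulVec gk.ofLp)

/-- The trial point `x_k⁺ = x_k - α_k d_k`. -/
def trial (st : QSASSState n) (gk : Vec n) : Vec n := st.x - st.α • I.dir st gk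

/-- The state after an iteration with gradient estimate `gk` and function estimates `fk` at the
current point and `fkp` at the trial point. -/
def next (st : QSASSState n) (gk : Vec n) (fk fkp : ℝ) : QSASSState n :=
  if fkp ≤ fk - st.α * I.θ * inner ℝ (I.dir st gk) gk + 2 * I.εf then
    ⟨I.trial st gk, I.γ⁻¹ * st.α, I.newMem st gk, some (st.x, gk)⟩
  else
    ⟨st.x, I.γ * st.α, I.newMem st gk, st.prev⟩

end QSASSInput

/-! ### The oracles -/

/-- A stochastic zeroth-order oracle: an estimate `f x ξ` of a function value at `x`, where the
law `law x` of the random element `ξ` may depend on `x`. -/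
structure ZerothOracle (n : ℕ) (S : Type*) [MeasurableSpace S] where
  law : Kernel (Vec n) S
  markov : IsMarkovKernel law
  f : Vec n → S → ℝ
  measurable_f : Measurable (Function.uncurry f)

/-- A stochastic first-order oracle: an estimate `g x α ξ` of a gradient at `x`, where the law
`law (x, α)` of the random element `ξ` may depend on the query. -/
structure FirstOracle (n : ℕ) (S : Type*) [MeasurableSpace S] where
  law : Kernel (Vec n × ℝ) S
  markov : IsMarkovKernel law
  g : Vec n → ℝ → S → Vec n
  measurable_g : Measurable fun q : (Vec n × ℝ) × S => g q.1.1 q.1.2 q.2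

/-- The absolute estimation error `e(x, ξ) = |f(x, ξ) - φ(x)|`. -/
def ZerothOracle.err {n : ℕ} {S : Type*} [MeasurableSpace S] (O : ZerothOracle n S)
    (φ : Vec n → ℝ) (x : Vec n) (ξ : S) : ℝ := |O.f x ξ - φ x|

/-- The mean `𝔼[e(x, Ξ)]`. -/
def ZerothOracle.meanErr {n : ℕ} {S : Type*} [MeasurableSpace S] (O : ZerothOracle n S)
    (φ : Vec n → ℝ) (x : Vec n) : ℝ := ∫ ξ, O.err φ x ξ ∂(O.law x)

/-- The probabilistic zeroth-order oracle assumption with parameters `(εf, ν, b)`. The condition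
`0 ≤ l`, `l * b ≤ 1` says `l ∈ [0, 1/b]`, with `1/b = ∞` for `b = 0`. -/
structure ZerothOracle.IsAccurate {n : ℕ} {S : Type*} [MeasurableSpace S] (O : ZerothOracle n S)
    (φ : Vec n → ℝ) (εf ν b : ℝ) : Prop where
  εf_nonneg : 0 ≤ εf
  ν_nonneg : 0 ≤ ν
  b_nonneg : 0 ≤ b
  integrable : ∀ x, Integrable (O.err φ x) (O.law x)
  mean_le : ∀ x, O.meanErr φ x ≤ εf
  exp_integrable : ∀ x, ∀ l : ℝ, 0 ≤ l → l * b ≤ 1 →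
    Integrable (fun ξ => Real.exp (l * (O.err φ x ξ - O.meanErr φ x))) (O.law x)
  mgf_le : ∀ x, ∀ l : ℝ, 0 ≤ l → l * b ≤ 1 →
    ∫ ξ, Real.exp (l * (O.err φ x ξ - O.meanErr φ x)) ∂(O.law x) ≤ Real.exp (l ^ 2 * ν ^ 2 / 2)

/-- The probabilistic first-order oracle assumption with parameters `(εg, τ, κ, δ)`. -/
structure FirstOracle.IsAccurate {n : ℕ} {S : Type*} [MeasurableSpace S] (O : FirstOracle n S)
    (φ : Vec n → ℝ) (εg τ κ δ : ℝ) : Prop where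
  εg_nonneg : 0 ≤ εg
  τ_nonneg : 0 ≤ τ
  κ_nonneg : 0 ≤ κ
  δ_mem : δ ∈ Set.Ico (0 : ℝ) (1 / 2)
  prob_ge : ∀ x, ∀ α : ℝ, 0 < α →
    1 - δ ≤ (O.law (x, α)).real
      {ξ | ‖O.g x α ξ - gradient φ x‖ ≤ max εg (min τ (κ * α) * ‖O.g x α ξ‖)}

/-! ### The stochastic process generated by the algorithm -/

section RandomProcess

variable {n : ℕ} {S₀ S₁ Ω : Type*} [MeasurableSpace S₀] [MeasurableSpace S₁]

/-- The state of Q-SASS at the beginning of iteration `k = 0, 1, 2, …`. The random elements used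
in iteration `k` are `ξg k` (gradient estimate), `ξ k` (function estimate at the current point) and
`ξp k` (function estimate at the trial point). -/
def qsassState (I : QSASSInput n) (O₀ : ZerothOracle n S₀) (O₁ : FirstOracle n S₁)
    (ξg : ℕ → Ω → S₁) (ξ ξp : ℕ → Ω → S₀) : ℕ → Ω → QSASSState n
  | 0, _ => I.init
  | k + 1, ω =>
      let st := qsassState I O₀ O₁ ξg ξ ξp k ω
      let gk := O₁.g st.x st.α (ξg k ω)
      I.next st gk (O₀.f st.x (ξ k ω)) (O₀.f (I.trial st gk) (ξp k ω))

/-- The trial point `X_k⁺`. -/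
def qsassTrial (I : QSASSInput n) (O₀ : ZerothOracle n S₀) (O₁ : FirstOracle n S₁)
    (ξg : ℕ → Ω → S₁) (ξ ξp : ℕ → Ω → S₀) (k : ℕ) (ω : Ω) : Vec n :=
  let st := qsassState I O₀ O₁ ξg ξ ξp k ω
  I.trial st (O₁.g st.x st.α (ξg k ω))

/-- The error `E_k = e(X_k, Ξ_k)`. -/
def qsassErr (I : QSASSInput n) (O₀ : ZerothOracle n S₀) (O₁ : FirstOracle n S₁)
    (φ : Vec n → ℝ) (ξg : ℕ → Ω → S₁) (ξ ξp : ℕ → Ω → S₀) (k : ℕ) (ω : Ω) : ℝ :=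
  O₀.err φ (qsassState I O₀ O₁ ξg ξ ξp k ω).x (ξ k ω)

/-- The error `E_k⁺ = e(X_k⁺, Ξ_k⁺)`. -/
def qsassErrTrial (I : QSASSInput n) (O₀ : ZerothOracle n S₀) (O₁ : FirstOracle n S₁)
    (φ : Vec n → ℝ) (ξg : ℕ → Ω → S₁) (ξ ξp : ℕ → Ω → S₀) (k : ℕ) (ω : Ω) : ℝ :=
  O₀.err φ (qsassTrial I O₀ O₁ ξg ξ ξp k ω) (ξp k ω)

/-- The σ-algebra `𝓕_{k-1}` generated by the random elements of the iterations before `k`. -/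
abbrev qsassPast (ξg : ℕ → Ω → S₁) (ξ ξp : ℕ → Ω → S₀) (k : ℕ) : MeasurableSpace Ω :=
  ⨆ j : Fin k, (MeasurableSpace.comap (ξg j) inferInstance ⊔
    MeasurableSpace.comap (ξ j) inferInstance ⊔ MeasurableSpace.comap (ξp j) inferInstance)

/-- The random elements answer the oracle calls of the algorithm: given the past, `ξg k` and `ξ k`
have the laws that the oracles prescribe at `(X_k, A_k)` and `X_k`; given the past and `ξg k`
(which determine `X_k⁺`), `ξp k` has the law prescribed at `X_k⁺`. Nothing is required about the
joint law of `ξ k` and `ξp k`. -/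
structure IsQSASSRun [MeasurableSpace Ω] (P : Measure Ω) (I : QSASSInput n)
    (O₀ : ZerothOracle n S₀) (O₁ : FirstOracle n S₁)
    (ξg : ℕ → Ω → S₁) (ξ ξp : ℕ → Ω → S₀) : Prop where
  measurable_ξg : ∀ k, Measurable (ξg k)
  measurable_ξ : ∀ k, Measurable (ξ k)
  measurable_ξp : ∀ k, Measurable (ξp k)
  law_ξg : ∀ k, ∀ B : Set S₁, MeasurableSet B →
    P⟦ξg k ⁻¹' B | qsassPast ξg ξ ξp k⟧ =ᵐ[P] fun ω =>
      (O₁.law ((qsassState I O₀ O₁ ξg ξ ξp k ω).x, (qsassState I O₀ O₁ ξg ξ ξp k ω).α)).real B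
  law_ξ : ∀ k, ∀ B : Set S₀, MeasurableSet B →
    P⟦ξ k ⁻¹' B | qsassPast ξg ξ ξp k⟧ =ᵐ[P] fun ω =>
      (O₀.law (qsassState I O₀ O₁ ξg ξ ξp k ω).x).real B
  law_ξp : ∀ k, ∀ B : Set S₀, MeasurableSet B →
    P⟦ξp k ⁻¹' B | qsassPast ξg ξ ξp k ⊔ MeasurableSpace.comap (ξg k) inferInstance⟧ =ᵐ[P]
      fun ω => (O₀.law (qsassTrial I O₀ O₁ ξg ξ ξp k ω)).real B

/-- The stopping time `T_ε = min {k : φ(X_k) - φ* ≤ ε}`, equal to `∞` if there is no such `k`. -/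
def qsassStop (I : QSASSInput n) (O₀ : ZerothOracle n S₀) (O₁ : FirstOracle n S₁)
    (φ : Vec n → ℝ) (φstar ε : ℝ) (ξg : ℕ → Ω → S₁) (ξ ξp : ℕ → Ω → S₀) (ω : Ω) : ℕ∞ :=
  ⨅ (k : ℕ) (_ : φ (qsassState I O₀ O₁ ξg ξ ξp k ω).x - φstar ≤ ε), (k : ℕ∞)

end RandomProcess

/-! ### The objective and the constants of the complexity bound -/

/-- `β`-strong convexity of a differentiable function. -/
def IsStronglyConvex {n : ℕ} (φ : Vec n → ℝ) (β : ℝ) : Prop :=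
  0 < β ∧ ∀ x y, φ x ≥ φ y + inner ℝ (gradient φ y) (x - y) + β / 2 * ‖x - y‖ ^ 2

/-- `exp (- min {u² / (2ν²), u / (2b)})` for `u, ν, b ≥ 0`, with the quotients taken in `[0, ∞]`:
`v / 0 = ∞` for `v > 0`, and `0 / 0 = 0`. -/
def subexpTail (u ν b : ℝ) : ℝ :=
  (EReal.exp (-((min (ENNReal.ofReal (u ^ 2) / ENNReal.ofReal (2 * ν ^ 2))
    (ENNReal.ofReal u / ENNReal.ofReal (2 * b)) : ℝ≥0∞) : EReal))).toReal

namespace QSASSInput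

variable {n : ℕ} (I : QSASSInput n)

/-- The step size `min {2(1-θ)σ_lb / ((2κ + Lσ_ub)σ_ub), 2((1-θ)(1-η)K - η) / (Lσ_ub(1-η))}`. -/
def αmax (L κ η : ℝ) : ℝ :=
  min (2 * (1 - I.θ) * I.σlb / ((2 * κ + L * I.σub) * I.σub))
    (2 * ((1 - I.θ) * (1 - η) * (I.σlb / I.σub) - η) / (L * I.σub * (1 - η)))

/-- `h(α) = min {-ln(1 - ασ_lbθβ/(1+τ)²), -ln(1 - ασ_lbβθ(1-η)²)}`. -/
def h (β τ η α : ℝ) : ℝ :=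
  min (-Real.log (1 - α * I.σlb * I.θ * β / (1 + τ) ^ 2))
    (-Real.log (1 - α * I.σlb * β * I.θ * (1 - η) ^ 2))

/-- The condition on the accuracy level `ε` in the strongly convex case. -/
def AccuracyLevel (L β εg τ κ η p ε : ℝ) : Prop :=
  η ∈ Set.Ioo 0 ((1 - I.θ * I.K) / (1 + (1 - I.θ) * I.K)) ∧ 1 / 2 < p ∧
  ε > max (εg ^ 2 / (2 * β * η ^ 2)) (max
    (4 * I.εf / ((1 - min (1 / (1 + τ) ^ 2) ((1 - η) ^ 2) * I.σlb * I.θ * β *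
      min (2 * (1 - I.θ) * I.K / (2 * κ + L * I.σub))
        (2 * ((1 - I.θ) * (1 - η) * I.K - η) / (L * I.σub * (1 - η)))) ^ (1 / 2 - p) - 1))
    (4 * I.εf))

end QSASSInput

/-- `4e² max {2ν/ε, 2b/ε} + 4e (1 + 4εf/ε)`, the common value of `ν_r` and `b_r`. -/
def subexpParam (εf ν b ε : ℝ) : ℝ :=
  4 * Real.exp 1 ^ 2 * max (2 * ν / ε) (2 * b / ε) + 4 * Real.exp 1 * (1 + 4 * εf / ε)

end

/-!
The proof follows a potential along the trajectory and then bounds the probability of the two ways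
in which the potential can fail to decrease.

Let `Φ_k = φ(X_k) - φ*` and write the step size as `αbar γ ^ (-j_k)` with `j_k ∈ ℤ`. Call an
iteration true if its gradient estimate is accurate and `E_k + E_k⁺ ≤ 2 εf`. As long as `Φ_k > ε`,
the quantity `2 log (Φ_k / ε) + h |j_k|` changes in one iteration by at most
`2 log (1 + Y_k) - h (2 J_k - 1)`, where `J_k` is the indicator of a true iteration and
`Y_k = (2 εf + E_k + E_k⁺) / ε` (`QSASSInput.Threshold.potential_step`). Three facts enter. The
spectral safeguard makes the quasi-Newton direction gradient related
(`QSASSInput.Admissible.dir_bounds`). A true iteration with step size at most `αbar` is accepted, by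
the descent lemma (`QSASSInput.Threshold.sufficient_decrease`). A true accepted iteration with step
size at least `αbar` contracts `Φ` by the factor `1 - 2q` up to noise, by the Polyak–Łojasiewicz
inequality; half of this contraction, together with `4 εf < ε`, lets the additive noise be written
as the factor `1 + Y_k` (`QSASSInput.log_gap_le`). Summing over `k < t`, the lower bound on `t`
forces `Φ_k ≤ ε` for some `k ≤ t` unless there are fewer than `phat t` true iterations or
`∑ log (1 + Y_k) > t (log (1 + 4 εf / ε) + s)`.

*Few true iterations.* Given the past an iteration is true with probability at least `p`
(`IsQSASSRun.mul_le_measureReal_trueEvent`). Since the state is a measurable function of the past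
(`measurableState_qsassState`), it may be frozen in the conditional laws
(`setLIntegral_comp_eq_of_condLaw`); the joint law of the two errors of an iteration, which is not
prescribed, is dealt with by `exp ((x + y) / 2) ≤ (exp x + exp y) / 2`. A Chernoff bound with
Hoeffding's lemma gives `measureReal_sum_indicator_lt_le`, where `p ≥ 1/2` turns the constant `1/8`
of Hoeffding's lemma into `p² / 2`.

*Large noise.* For bounded noise this event is null. For independent noise
`𝔼 ∏ (1 + Y_k) = ∏ 𝔼 (1 + Y_k) ≤ (1 + 4 εf / ε) ^ t`, so Markov's inequality bounds its probability
by `exp (-s t)` (`IsQSASSRun.measureReal_noise_le`), which is smaller than the stated tail because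
`subexpParam` is at least `4`.
-/

/-! ### Spectral bounds for the quasi-Newton direction -/

lemma isHermitian_bfgsUpdate {n : ℕ} {B : Matrix (Fin n) (Fin n) ℝ} (hB : B.IsHermitian)
    (s y : Vec n) : (bfgsUpdate B s y).IsHermitian := by
  have hBt : B.transpose = B := by
    rw [← Matrix.conjTranspose_eq_transpose_of_trivial]; exact hB
  have hvm : Matrix.vecMul s.ofLp B = B.mulVec s.ofLp := by
    conv_lhs => rw [← hBt]
    exact Matrix.vecMul_transpose B s.ofLp
  rw [Matrix.IsHermitian, Matrix.conjTranspose_eq_transpose_of_trivial, bfgsUpdate, hvm]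
  simp [Matrix.transpose_vecMulVec, hBt]

lemma isHermitian_lbfgsMatrix {n : ℕ} (c : ℝ) (mem : List (Vec n × Vec n)) :
    (lbfgsMatrix c mem).IsHermitian := by
  have key : ∀ (l : List (Vec n × Vec n)) (B : Matrix (Fin n) (Fin n) ℝ), B.IsHermitian →
      (l.foldl (fun B sy => bfgsUpdate B sy.1 sy.2) B).IsHermitian := by
    intro l
    induction l with
    | nil => intro B hB; exact hB
    | cons a l ih => intro B hB; exact ih _ (isHermitian_bfgsUpdate hB _ _)
  refine key mem _ ?_
  simp [Matrix.IsHermitian]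

/-- If the spectrum of a symmetric matrix `B` lies in `[l, u]` with `l > 0`, then `d = B⁻¹ g`
is a gradient-related direction. -/
lemma Matrix.IsHermitian.inner_inv_mulVec_bounds {n : ℕ} {B : Matrix (Fin n) (Fin n) ℝ}
    (hB : B.IsHermitian) {l u : ℝ} (hl : 0 < l) (hu : 0 < u)
    (h : ∀ μ ∈ spectrum ℝ B, l ≤ μ ∧ μ ≤ u) (g : Vec n) :
    u⁻¹ * ‖g‖ ^ 2 ≤ inner ℝ (WithLp.toLp 2 (B⁻¹.mulVec g.ofLp) : Vec n) g ∧
      ‖(WithLp.toLp 2 (B⁻¹.mulVec g.ofLp) : Vec n)‖ ≤ l⁻¹ * ‖g‖ := by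
  set d : Vec n := WithLp.toLp 2 (B⁻¹.mulVec g.ofLp) with hd
  have hunit : IsUnit B := by
    by_contra hcon
    have := (h 0 (by rw [spectrum.zero_mem_iff]; exact hcon)).1
    linarith
  have hg : g.ofLp = B.mulVec d.ofLp := by
    have hdet : IsUnit B.det := (Matrix.isUnit_iff_isUnit_det B).1 hunit
    rw [hd]
    simp only [Matrix.mulVec_mulVec]
    rw [Matrix.mul_nonsing_inv B hdet, Matrix.one_mulVec]
  have hBt : B.transpose = B := by
    rw [← Matrix.conjTranspose_eq_transpose_of_trivial]; exact hB
  set e := hB.eigenvectorBasis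
  have hcoef : ∀ i, inner ℝ (e i) g = hB.eigenvalues i * inner ℝ (e i) d := by
    intro i
    have h1 : inner ℝ (e i) g = (e i).ofLp ⬝ᵥ B.mulVec d.ofLp := by
      rw [← hg, EuclideanSpace.inner_eq_star_dotProduct, dotProduct_comm]; simp
    have h2 : inner ℝ (e i) d = (e i).ofLp ⬝ᵥ d.ofLp := by
      rw [EuclideanSpace.inner_eq_star_dotProduct, dotProduct_comm]; simp
    rw [h1, h2, Matrix.dotProduct_mulVec, ← Matrix.mulVec_transpose, hBt,
      hB.mulVec_eigenvectorBasis, smul_dotProduct, smul_eq_mul]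
  have hev : ∀ i, l ≤ hB.eigenvalues i ∧ hB.eigenvalues i ≤ u := fun i =>
    h _ (hB.eigenvalues_mem_spectrum_real i)
  have hgg : ‖g‖ ^ 2 = ∑ i, hB.eigenvalues i ^ 2 * inner ℝ (e i) d ^ 2 := by
    rw [← real_inner_self_eq_norm_sq, ← e.sum_inner_mul_inner]
    refine Finset.sum_congr rfl fun i _ => ?_
    rw [real_inner_comm, hcoef]; ring
  have hdd : ‖d‖ ^ 2 = ∑ i, inner ℝ (e i) d ^ 2 := by
    rw [← real_inner_self_eq_norm_sq, ← e.sum_inner_mul_inner]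
    refine Finset.sum_congr rfl fun i _ => ?_
    rw [real_inner_comm]; ring
  have hdg : inner ℝ d g = ∑ i, hB.eigenvalues i * inner ℝ (e i) d ^ 2 := by
    rw [← e.sum_inner_mul_inner]
    refine Finset.sum_congr rfl fun i _ => ?_
    rw [real_inner_comm, hcoef]; ring
  constructor
  · rw [hgg, hdg, Finset.mul_sum]
    refine Finset.sum_le_sum fun i _ => ?_
    obtain ⟨h1, h2⟩ := hev i
    rw [← mul_assoc]
    refine mul_le_mul_of_nonneg_right ?_ (sq_nonneg _)
    rw [inv_mul_le_iff₀ hu, sq]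
    exact mul_le_mul_of_nonneg_right h2 (hl.le.trans h1)
  · rw [le_inv_mul_iff₀ hl]
    refine le_of_sq_le_sq ?_ (norm_nonneg _)
    rw [mul_pow, hgg, hdd, Finset.mul_sum]
    refine Finset.sum_le_sum fun i _ => mul_le_mul_of_nonneg_right ?_ (sq_nonneg _)
    exact pow_le_pow_left₀ hl.le (hev i).1 2

lemma spectrum_lbfgsMatrix_nil {n : ℕ} {c lb ub : ℝ} (hc : c ∈ Set.Icc lb ub) :
    ∀ μ ∈ spectrum ℝ (lbfgsMatrix (n := n) c []), lb ≤ μ ∧ μ ≤ ub := by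
  intro μ hμ
  rcases subsingleton_or_nontrivial (Matrix (Fin n) (Fin n) ℝ) with hn | hn
  · rw [spectrum.of_subsingleton] at hμ; exact hμ.elim
  · have : lbfgsMatrix (n := n) c [] = algebraMap ℝ _ c := by
      rw [Algebra.algebraMap_eq_smul_one]; rfl
    rw [this, spectrum.scalar_eq] at hμ
    rw [Set.mem_singleton_iff] at hμ
    rw [hμ]; exact hc

lemma spectrum_enforceSpectrum {n : ℕ} {c lb ub : ℝ} (hc : c ∈ Set.Icc lb ub)
    (mem : List (Vec n × Vec n)) :
    ∀ μ ∈ spectrum ℝ (lbfgsMatrix c (enforceSpectrum c lb ub mem)), lb ≤ μ ∧ μ ≤ ub := by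
  induction mem with
  | nil => exact spectrum_lbfgsMatrix_nil hc
  | cons sy mem ih =>
    rw [enforceSpectrum]
    split_ifs with h
    · exact fun μ hμ => ⟨(h μ hμ).1.le, (h μ hμ).2.le⟩
    · exact ih

namespace QSASSInput

variable {n : ℕ} {I : QSASSInput n}

lemma Admissible.ubB_pos (hI : I.Admissible) : 0 < I.ubB :=
  hI.lbB_pos.trans_le (hI.c_mem.1.trans hI.c_mem.2)

lemma Admissible.σlb_pos (hI : I.Admissible) : 0 < I.σlb := inv_pos.2 hI.ubB_pos

lemma Admissible.σub_pos (hI : I.Admissible) : 0 < I.σub := inv_pos.2 hI.lbB_pos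

lemma Admissible.σlb_le_σub (hI : I.Admissible) : I.σlb ≤ I.σub :=
  inv_anti₀ hI.lbB_pos (hI.c_mem.1.trans hI.c_mem.2)

/-- The search direction is gradient related. The hypothesis excludes stored pairs that were never
checked by the spectral safeguard. -/
lemma Admissible.dir_bounds (hI : I.Admissible) {st : QSASSState n}
    (hst : st.prev = none → st.mem = []) (g : Vec n) :
    I.σlb * ‖g‖ ^ 2 ≤ inner ℝ (I.dir st g) g ∧ ‖I.dir st g‖ ≤ I.σub * ‖g‖ := by
  refine (isHermitian_lbfgsMatrix I.c (I.newMem st g)).inner_inv_mulVec_bounds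
    hI.lbB_pos hI.ubB_pos ?_ g
  unfold newMem
  split
  · rename_i h
    rw [hst h]; exact spectrum_lbfgsMatrix_nil hI.c_mem
  · exact spectrum_enforceSpectrum hI.c_mem _

end QSASSInput

section RandomProcess

variable {n : ℕ} {S₀ S₁ Ω : Type*} [MeasurableSpace S₀] [MeasurableSpace S₁]
  {I : QSASSInput n} {O₀ : ZerothOracle n S₀} {O₁ : FirstOracle n S₁}
  {ξg : ℕ → Ω → S₁} {ξ ξp : ℕ → Ω → S₀}

lemma qsassState_mem_eq_nil (k : ℕ) (ω : Ω) :
    (qsassState I O₀ O₁ ξg ξ ξp k ω).prev = none →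
      (qsassState I O₀ O₁ ξg ξ ξp k ω).mem = [] := by
  induction k with
  | zero => intro _; rfl
  | succ k ih =>
    simp only [qsassState, QSASSInput.next]
    split_ifs
    · simp
    · intro h
      simp only [QSASSInput.newMem] at h ⊢
      rw [h]; exact ih h

/-- All step sizes lie on the grid `α₀ γ ^ ℤ`. -/
lemma exists_qsassState_α_eq (hI : I.Admissible) (k : ℕ) (ω : Ω) :
    ∃ i : ℤ, (qsassState I O₀ O₁ ξg ξ ξp k ω).α = I.α₀ * I.γ ^ i := by
  have hγ : I.γ ≠ 0 := hI.γ_mem.1.ne'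
  induction k with
  | zero => exact ⟨0, by simp [qsassState, QSASSInput.init]⟩
  | succ k ih =>
    obtain ⟨i, hi⟩ := ih
    simp only [qsassState, QSASSInput.next]
    split_ifs
    · exact ⟨i - 1, by simp only [hi, zpow_sub_one₀ hγ]; ring⟩
    · exact ⟨i + 1, by simp only [hi, zpow_add_one₀ hγ]; ring⟩

lemma qsassState_α_pos (hI : I.Admissible) (k : ℕ) (ω : Ω) :
    0 < (qsassState I O₀ O₁ ξg ξ ξp k ω).α := by
  obtain ⟨i, hi⟩ := exists_qsassState_α_eq (O₀ := O₀) (O₁ := O₁) (ξg := ξg) (ξ := ξ) (ξp := ξp)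
    hI k ω
  rw [hi]
  exact mul_pos hI.α₀_pos (zpow_pos hI.γ_mem.1 i)

end RandomProcess

/-! ### Smooth strongly convex functions -/

/-- The descent lemma. -/
lemma LipschitzWith.le_add_inner_gradient {n : ℕ} {φ : Vec n → ℝ} {L : ℝ≥0}
    (hdiff : Differentiable ℝ φ) (hLip : LipschitzWith L (gradient φ)) (x v : Vec n) :
    φ (x + v) ≤ φ x + inner ℝ (gradient φ x) v + L / 2 * ‖v‖ ^ 2 := by
  have hder : ∀ r : ℝ, HasDerivAt
      (fun r : ℝ => φ (x + r • v) - r * inner ℝ (gradient φ x) v - r ^ 2 * (L / 2 * ‖v‖ ^ 2))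
      (inner ℝ (gradient φ (x + r • v)) v - inner ℝ (gradient φ x) v
        - 2 * r * (L / 2 * ‖v‖ ^ 2)) r := by
    intro r
    have h1 : HasDerivAt (fun r : ℝ => x + r • v) v r := by
      simpa using ((hasDerivAt_id r).smul_const v).const_add x
    have h2 := (hdiff (x + r • v)).hasGradientAt.hasFDerivAt.comp_hasDerivAt r h1
    rw [InnerProductSpace.toDual_apply_apply] at h2
    have h3 : HasDerivAt (fun r : ℝ => r * inner ℝ (gradient φ x) v)
        (inner ℝ (gradient φ x) v) r := by
      simpa using (hasDerivAt_id r).mul_const (inner ℝ (gradient φ x) v)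
    have h4 : HasDerivAt (fun r : ℝ => r ^ 2 * (L / 2 * ‖v‖ ^ 2))
        (2 * r * (L / 2 * ‖v‖ ^ 2)) r := by
      simpa using (hasDerivAt_pow 2 r).mul_const ((L : ℝ) / 2 * ‖v‖ ^ 2)
    exact (h2.sub h3).sub h4
  have hanti : AntitoneOn (fun r : ℝ => φ (x + r • v) - r * inner ℝ (gradient φ x) v
      - r ^ 2 * (L / 2 * ‖v‖ ^ 2)) (Set.Icc 0 1) := by
    refine antitoneOn_of_deriv_nonpos (convex_Icc 0 1)
      (fun r _ => (hder r).continuousAt.continuousWithinAt)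
      (fun r _ => (hder r).differentiableAt.differentiableWithinAt) ?_
    intro r hr
    rw [interior_Icc] at hr
    rw [(hder r).deriv, ← inner_sub_left]
    have h1 := real_inner_le_norm (gradient φ (x + r • v) - gradient φ x) v
    have h2 := hLip.dist_le_mul (x + r • v) x
    rw [dist_eq_norm, dist_eq_norm, add_sub_cancel_left, norm_smul, Real.norm_of_nonneg hr.1.le]
      at h2
    nlinarith [norm_nonneg v]
  have h := hanti (Set.left_mem_Icc.2 zero_le_one) (Set.right_mem_Icc.2 zero_le_one) zero_le_one
  simp only [one_smul, one_mul, one_pow, zero_smul, add_zero, zero_mul, sub_zero,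
    zero_pow two_ne_zero] at h
  linarith

/-- The Polyak–Łojasiewicz inequality. -/
lemma IsStronglyConvex.two_mul_le_norm_gradient_sq {n : ℕ} {φ : Vec n → ℝ} {φstar β : ℝ}
    (hconv : IsStronglyConvex φ β) (hstar : IsGLB (Set.range φ) φstar) (y : Vec n) :
    2 * β * (φ y - φstar) ≤ ‖gradient φ y‖ ^ 2 := by
  obtain ⟨hβ, hc⟩ := hconv
  have hlb : φ y - ‖gradient φ y‖ ^ 2 / (2 * β) ≤ φstar := by
    refine hstar.2 ?_
    rintro _ ⟨x, rfl⟩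
    have h1 := hc x y
    have h2 := neg_le_of_abs_le (abs_real_inner_le_norm (gradient φ y) (x - y))
    have h3 : ‖gradient φ y‖ ^ 2 / (2 * β) - ‖gradient φ y‖ * ‖x - y‖ + β / 2 * ‖x - y‖ ^ 2
        = (‖gradient φ y‖ - β * ‖x - y‖) ^ 2 / (2 * β) := by
      field_simp; ring
    have h4 : 0 ≤ (‖gradient φ y‖ - β * ‖x - y‖) ^ 2 / (2 * β) := by positivity
    linarith
  have h5 : φ y - φstar ≤ ‖gradient φ y‖ ^ 2 / (2 * β) := by linarith
  rw [le_div_iff₀ (by positivity)] at h5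
  linarith

lemma IsStronglyConvex.le_lipschitz {n : ℕ} {φ : Vec n → ℝ} {β : ℝ} {L : ℝ≥0}
    (hconv : IsStronglyConvex φ β) (hLip : LipschitzWith L (gradient φ)) {x y : Vec n}
    (hxy : x ≠ y) : β ≤ L := by
  obtain ⟨hβ, hc⟩ := hconv
  have h1 := hc x y
  have h2 := hc y x
  have h3 := real_inner_le_norm (gradient φ x - gradient φ y) (x - y)
  have h4 := hLip.dist_le_mul x y
  rw [dist_eq_norm, dist_eq_norm] at h4
  have hpos : 0 < ‖x - y‖ := norm_pos_iff.2 (sub_ne_zero.2 hxy)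
  rw [inner_sub_left] at h3
  have h5 : inner ℝ (gradient φ x) (y - x) = - inner ℝ (gradient φ x) (x - y) := by
    rw [← inner_neg_right, neg_sub]
  rw [h5, norm_sub_rev y x] at h2
  have h6 : β * ‖x - y‖ ^ 2 ≤ L * ‖x - y‖ ^ 2 := by
    nlinarith
  exact le_of_mul_le_mul_right h6 (by positivity)

/-! ### One iteration of the algorithm -/

/-- The condition that the gradient estimate `g` at `x` with step size `α` meets the accuracy
requirement of the first-order oracle. -/
def IsAccurateGradient {n : ℕ} (φ : Vec n → ℝ) (εg τ κ : ℝ) (x : Vec n) (α : ℝ) (g : Vec n) :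
    Prop :=
  ‖g - gradient φ x‖ ≤ max εg (min τ (κ * α) * ‖g‖)

/-- What a one-step analysis needs to know about the step size threshold `αbar`: the two bounds
hidden in `αbar ≤ αmax`, cleared of denominators, and the resulting contraction rate. -/
structure QSASSInput.Threshold {n : ℕ} (I : QSASSInput n) (L β τ κ η αbar : ℝ) : Prop where
  pos : 0 < αbar
  η_pos : 0 < η
  η_lt : η < 1
  le_left : αbar * (2 * κ + L * I.σub) * I.σub ≤ 2 * (1 - I.θ) * I.σlb
  le_right : αbar * L * I.σub ^ 2 * (1 - η) ≤ 2 * ((1 - I.θ) * (1 - η) * I.σlb - η * I.σub)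
  contraction_le : αbar * I.σlb * I.θ * β ≤ 1 / 2
  h_pos : 0 < I.h β τ η αbar

namespace QSASSInput

variable {n : ℕ} {I : QSASSInput n}

lemma Admissible.threshold (hI : I.Admissible) {L β τ κ η αbar : ℝ} (hβ : 0 < β)
    (hβL : β ≤ L) (hτ : 0 ≤ τ) (hκ : 0 ≤ κ)
    (hη : η ∈ Set.Ioo 0 ((1 - I.θ * I.K) / (1 + (1 - I.θ) * I.K)))
    (hpos : 0 < αbar) (hle : αbar ≤ I.αmax L κ η) : I.Threshold L β τ κ η αbar := by
  have hlb := hI.σlb_pos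
  have hub := hI.σub_pos
  have hLpos : 0 < L := hβ.trans_le hβL
  obtain ⟨hθ0, hθ1⟩ := hI.θ_mem
  have hK : 0 < I.K := div_pos hlb hub
  have hη1 : η < 1 := by
    refine hη.2.trans_le ?_
    rw [div_le_one (by nlinarith)]
    nlinarith
  have hη1' : 0 < 1 - η := by linarith
  have h1 : αbar ≤ 2 * (1 - I.θ) * I.σlb / ((2 * κ + L * I.σub) * I.σub) :=
    hle.trans (min_le_left _ _)
  have h2 : αbar ≤ 2 * ((1 - I.θ) * (1 - η) * (I.σlb / I.σub) - η) / (L * I.σub * (1 - η)) :=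
    hle.trans (min_le_right _ _)
  rw [le_div_iff₀ (by positivity)] at h1 h2
  have h2' : αbar * L * I.σub ^ 2 * (1 - η) ≤
      2 * ((1 - I.θ) * (1 - η) * I.σlb - η * I.σub) := by
    have h3 := mul_le_mul_of_nonneg_right h2 hub.le
    have h4 : 2 * ((1 - I.θ) * (1 - η) * (I.σlb / I.σub) - η) * I.σub =
        2 * ((1 - I.θ) * (1 - η) * I.σlb - η * I.σub) := by
      field_simp
    rw [h4] at h3
    linarith
  have hq : αbar * I.σlb * I.θ * β ≤ 1 / 2 := by
    have h3 : αbar * L * I.σub ^ 2 ≤ 2 * (1 - I.θ) * I.σlb := by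
      have : 0 ≤ αbar * (2 * κ) * I.σub := by positivity
      nlinarith
    have h4 : αbar * I.σlb * I.θ * β * I.σub ^ 2 ≤ 1 / 2 * I.σub ^ 2 := by
      calc αbar * I.σlb * I.θ * β * I.σub ^ 2
          ≤ αbar * I.σlb * I.θ * L * I.σub ^ 2 := by gcongr
        _ = I.σlb * I.θ * (αbar * L * I.σub ^ 2) := by ring
        _ ≤ I.σlb * I.θ * (2 * (1 - I.θ) * I.σlb) := by gcongr
        _ = 2 * (I.θ * (1 - I.θ)) * I.σlb ^ 2 := by ring
        _ ≤ 2 * (1 / 4) * I.σub ^ 2 := by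
          have h5 : I.θ * (1 - I.θ) ≤ 1 / 4 := by nlinarith [sq_nonneg (I.θ - 1 / 2)]
          have h6 := hI.σlb_le_σub
          gcongr
        _ = 1 / 2 * I.σub ^ 2 := by ring
    exact le_of_mul_le_mul_right h4 (by positivity)
  have hq0 : 0 < αbar * I.σlb * I.θ * β := by positivity
  have hlog : ∀ c : ℝ, 0 < c → c ≤ 1 → 0 < -Real.log (1 - αbar * I.σlb * I.θ * β * c) := by
    intro c hc0 hc1
    have h3 : 0 < αbar * I.σlb * I.θ * β * c := by positivity
    have h4 : αbar * I.σlb * I.θ * β * c ≤ 1 / 2 * 1 := by gcongr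
    have := Real.log_neg (x := 1 - αbar * I.σlb * I.θ * β * c) (by linarith) (by linarith)
    linarith
  refine ⟨hpos, hη.1, hη1, by linarith, h2', hq, lt_min ?_ ?_⟩
  · have h3 := hlog (1 / (1 + τ) ^ 2) (by positivity)
      (by rw [div_le_one (by positivity)]; nlinarith)
    rwa [mul_one_div] at h3
  · have h3 := hlog ((1 - η) ^ 2) (by positivity) (by nlinarith [hη.1])
    have h4 : αbar * I.σlb * β * I.θ * (1 - η) ^ 2 = αbar * I.σlb * I.θ * β * (1 - η) ^ 2 := by
      ring
    rwa [← h4] at h3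

section Step

variable {φ : Vec n → ℝ} {φstar β : ℝ} {L : ℝ≥0} {εg τ κ η αbar ε : ℝ}

/-- An accurate gradient estimate at a point that is not yet `ε`-optimal is accurate relative to
its own length, and its length controls that of the gradient. -/
lemma _root_.IsAccurateGradient.relative (hconv : IsStronglyConvex φ β)
    (hstar : IsGLB (Set.range φ) φstar) (hη0 : 0 < η) (hη1 : η < 1)
    (hε : εg ^ 2 / (2 * β * η ^ 2) < ε) {x g : Vec n} {α : ℝ} (hx : ε < φ x - φstar)
    (hg : IsAccurateGradient φ εg τ κ x α g) :
    (‖g - gradient φ x‖ ≤ κ * α * ‖g‖ ∧ ‖gradient φ x‖ ≤ (1 + τ) * ‖g‖) ∨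
      (‖g - gradient φ x‖ ≤ η / (1 - η) * ‖g‖ ∧ (1 - η) * ‖gradient φ x‖ ≤ ‖g‖) := by
  have hβ := hconv.1
  have htri := norm_sub_norm_le (gradient φ x) g
  rw [norm_sub_rev] at htri
  rcases le_max_iff.1 hg with h | h
  · right
    have hPL := hconv.two_mul_le_norm_gradient_sq hstar x
    have h1 : εg ≤ η * ‖gradient φ x‖ := by
      refine le_of_sq_le_sq ?_ (by positivity)
      rw [div_lt_iff₀ (by positivity)] at hε
      have h2 : ε * (2 * β * η ^ 2) ≤ (φ x - φstar) * (2 * β * η ^ 2) := by gcongr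
      have h3 : 2 * β * (φ x - φstar) * η ^ 2 ≤ ‖gradient φ x‖ ^ 2 * η ^ 2 := by gcongr
      rw [mul_pow]
      linarith
    have h4 : (1 - η) * ‖gradient φ x‖ ≤ ‖g‖ := by linarith
    refine ⟨?_, h4⟩
    have h5 : 0 < 1 - η := by linarith
    rw [div_mul_eq_mul_div, le_div_iff₀ h5]
    nlinarith
  · left
    constructor
    · exact h.trans (mul_le_mul_of_nonneg_right (min_le_right _ _) (norm_nonneg _))
    · have h1 : ‖g - gradient φ x‖ ≤ τ * ‖g‖ :=
        h.trans (mul_le_mul_of_nonneg_right (min_le_left _ _) (norm_nonneg _))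
      linarith

/-- With an accurate gradient estimate and a step size below the threshold, the trial point
satisfies the noiseless sufficient decrease condition. -/
lemma Threshold.sufficient_decrease (hI : I.Admissible) (hdiff : Differentiable ℝ φ)
    (hLip : LipschitzWith L (gradient φ)) (hconv : IsStronglyConvex φ β)
    (hstar : IsGLB (Set.range φ) φstar) (hκ : 0 ≤ κ)
    (hT : I.Threshold L β τ κ η αbar) (hε : εg ^ 2 / (2 * β * η ^ 2) < ε)
    {st : QSASSState n} (hst : st.prev = none → st.mem = []) (hα : 0 < st.α)
    (hαbar : st.α ≤ αbar) (hx : ε < φ st.x - φstar) {g : Vec n}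
    (hg : IsAccurateGradient φ εg τ κ st.x st.α g) :
    φ (I.trial st g) ≤ φ st.x - st.α * I.θ * inner ℝ (I.dir st g) g := by
  obtain ⟨hd1, hd2⟩ := hI.dir_bounds hst g
  obtain ⟨hθ0, hθ1⟩ := hI.θ_mem
  have hlb := hI.σlb_pos
  have hub := hI.σub_pos
  have hη1 : 0 < 1 - η := by linarith [hT.η_lt]
  have key : ∀ a : ℝ, ‖g - gradient φ st.x‖ ≤ a * ‖g‖ →
      a * I.σub + L / 2 * st.α * I.σub ^ 2 ≤ (1 - I.θ) * I.σlb →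
      φ (I.trial st g) ≤ φ st.x - st.α * I.θ * inner ℝ (I.dir st g) g := by
    intro a ha hbound
    have h1 := hLip.le_add_inner_gradient hdiff st.x (-(st.α • I.dir st g))
    rw [← sub_eq_add_neg, norm_neg, norm_smul, Real.norm_of_nonneg hα.le, inner_neg_right,
      inner_smul_right] at h1
    have h2 : inner ℝ (gradient φ st.x) (I.dir st g) =
        inner ℝ (I.dir st g) g - inner ℝ (g - gradient φ st.x) (I.dir st g) := by
      rw [inner_sub_left, real_inner_comm g]; ring
    have h3 := real_inner_le_norm (g - gradient φ st.x) (I.dir st g)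
    have h4 : ‖g - gradient φ st.x‖ * ‖I.dir st g‖ ≤ (a * ‖g‖) * (I.σub * ‖g‖) := by
      gcongr
      exact (norm_nonneg _).trans ha
    have h5 : (L : ℝ) / 2 * st.α * ‖I.dir st g‖ ^ 2 ≤ L / 2 * st.α * (I.σub * ‖g‖) ^ 2 := by
      gcongr
    have h6 := mul_le_mul_of_nonneg_right hbound (sq_nonneg ‖g‖)
    have h7 := mul_le_mul_of_nonneg_left hd1 (by linarith : 0 ≤ 1 - I.θ)
    have h8 : inner ℝ (g - gradient φ st.x) (I.dir st g) + L / 2 * st.α * ‖I.dir st g‖ ^ 2 ≤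
        (1 - I.θ) * inner ℝ (I.dir st g) g := by linarith
    have h9 := mul_le_mul_of_nonneg_left h8 hα.le
    rw [h2] at h1
    unfold trial
    linarith
  have hL : (0 : ℝ) ≤ L := L.2
  have hαub : st.α * I.σub ≤ αbar * I.σub := by gcongr
  have hαL : (L : ℝ) * st.α * I.σub ^ 2 ≤ L * αbar * I.σub ^ 2 := by gcongr
  rcases hg.relative hconv hstar hT.η_pos hT.η_lt hε hx with ⟨h, -⟩ | ⟨h, -⟩
  · refine key _ h ?_
    have h1 := hT.le_left
    have h2 := mul_le_mul_of_nonneg_left hαub hκ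
    linarith
  · refine key _ h ?_
    have h1 : (αbar * L * I.σub ^ 2) * (1 - η) ≤
      (2 * ((1 - I.θ) * I.σlb - η / (1 - η) * I.σub)) * (1 - η) := by
      have h2 := hT.le_right
      have h3 : (2 * ((1 - I.θ) * I.σlb - η / (1 - η) * I.σub)) * (1 - η) =
        2 * ((1 - I.θ) * (1 - η) * I.σlb - η * I.σub) := by field_simp
      rw [h3]; exact h2
    have h2 := le_of_mul_le_mul_right h1 hη1
    linarith

/-- An accepted step increases the objective by at most the noise, minus the predicted
decrease. -/
lemma trial_le_of_accept {st : QSASSState n} {g : Vec n} {fk fkp E Ep : ℝ}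
    (hE : |fk - φ st.x| ≤ E) (hEp : |fkp - φ (I.trial st g)| ≤ Ep)
    (hacc : fkp ≤ fk - st.α * I.θ * inner ℝ (I.dir st g) g + 2 * I.εf) :
    φ (I.trial st g) ≤ φ st.x - st.α * I.θ * inner ℝ (I.dir st g) g + (2 * I.εf + E + Ep) := by
  have h1 := abs_le.1 hE
  have h2 := abs_le.1 hEp
  linarith

/-- Passing to logarithms, the decrease of an accurate iteration contracts the optimality gap `Φ`
by `1 - 2q` up to noise `r ≤ ε`; half of the contraction absorbs the cross term that appears when
the noise is written as a factor `1 + r / ε`. -/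
lemma log_gap_le {Φ Φ' r q ε : ℝ} (hε : 0 < ε) (hΦ : ε ≤ Φ) (hΦ' : 0 < Φ') (hr0 : 0 ≤ r)
    (hr : r ≤ ε) (hq0 : 0 ≤ q) (hq : q < 1) (h : Φ' ≤ (1 - 2 * q) * Φ + r) :
    Real.log (Φ' / ε) ≤ Real.log (Φ / ε) + Real.log (1 + r / ε) + Real.log (1 - q) := by
  have hΦ0 : 0 < Φ := hε.trans_le hΦ
  have hre : 0 ≤ r / ε := by positivity
  rw [← Real.log_mul (by positivity) (by positivity),
    ← Real.log_mul (by positivity) (by linarith)]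
  refine Real.log_le_log (by positivity) ?_
  have h1 : Φ / ε * (1 + r / ε) * (1 - q) = (Φ * (1 + r / ε) * (1 - q)) / ε := by ring
  rw [h1]
  refine div_le_div_of_nonneg_right (h.trans ?_) hε.le
  -- the difference is `q Φ + (1 - q) r Φ / ε - r`, which is at least `q Φ - q r`
  have h2 : r ≤ Φ * (r / ε) := by
    rw [mul_div_assoc', le_div_iff₀ hε]; nlinarith
  have h3 : (1 - q) * r ≤ (1 - q) * (Φ * (r / ε)) :=
    mul_le_mul_of_nonneg_left h2 (by linarith)
  have h4 : q * r ≤ q * Φ := mul_le_mul_of_nonneg_left (hr.trans hΦ) hq0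
  linarith

/-- Drift of the potential `2 log (Φ / ε) + h |j|`, where `Φ` is the optimality gap and the step
size is `αbar γ ^ (-j)`, over an iteration that starts and ends with gap above `ε`. Below the
threshold (`j ≤ 0`) an accurate iteration is accepted; an accurate and accepted one above it
(`j ≥ 0`) contracts the gap by `exp (-h)`; a rejected one above the threshold moves `j` towards
`0`. -/
lemma Threshold.potential_step (hI : I.Admissible) (hdiff : Differentiable ℝ φ)
    (hLip : LipschitzWith L (gradient φ)) (hconv : IsStronglyConvex φ β)
    (hstar : IsGLB (Set.range φ) φstar) (hτ : 0 ≤ τ) (hκ : 0 ≤ κ) (hεf : 0 ≤ I.εf)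
    (hT : I.Threshold L β τ κ η αbar) (hε : εg ^ 2 / (2 * β * η ^ 2) < ε) (hε4 : 4 * I.εf < ε)
    {st : QSASSState n} (hst : st.prev = none → st.mem = []) {j : ℤ}
    (hj : st.α = αbar * I.γ ^ (-j)) (hx : ε < φ st.x - φstar) {g : Vec n} {fk fkp E Ep : ℝ}
    (hE : |fk - φ st.x| ≤ E) (hEp : |fkp - φ (I.trial st g)| ≤ Ep)
    (hx' : ε < φ (I.next st g fk fkp).x - φstar) {J : Prop} [Decidable J]
    (hJ : J → IsAccurateGradient φ εg τ κ st.x st.α g ∧ E + Ep ≤ 2 * I.εf) :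
    ∃ j' : ℤ, (I.next st g fk fkp).α = αbar * I.γ ^ (-j') ∧
      2 * Real.log ((φ (I.next st g fk fkp).x - φstar) / ε) + I.h β τ η αbar * |(j' : ℝ)| ≤
        2 * Real.log ((φ st.x - φstar) / ε) + I.h β τ η αbar * |(j : ℝ)| +
          2 * Real.log (1 + (2 * I.εf + (E + Ep)) / ε) -
          I.h β τ η αbar * (2 * (if J then 1 else 0) - 1) := by
  obtain ⟨hγ0, hγ1⟩ := hI.γ_mem
  have hα : 0 < st.α := by rw [hj]; exact mul_pos hT.pos (zpow_pos hγ0 _)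
  have hε0 : 0 < ε := lt_of_le_of_lt (by positivity) hε4
  have hE0 : 0 ≤ E := (abs_nonneg _).trans hE
  have hEp0 : 0 ≤ Ep := (abs_nonneg _).trans hEp
  have hh := hT.h_pos
  have hdg : 0 ≤ inner ℝ (I.dir st g) g :=
    le_trans (mul_nonneg hI.σlb_pos.le (sq_nonneg _)) (hI.dir_bounds hst g).1
  have hθ0 := hI.θ_mem.1
  have hr0 : 0 ≤ 2 * I.εf + (E + Ep) := by positivity
  have hre : 0 ≤ Real.log (1 + (2 * I.εf + (E + Ep)) / ε) :=
    Real.log_nonneg (by have : 0 ≤ (2 * I.εf + (E + Ep)) / ε := by positivity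
                        linarith)
  set h := I.h β τ η αbar
  by_cases hacc : fkp ≤ fk - st.α * I.θ * inner ℝ (I.dir st g) g + 2 * I.εf
  · have hnext : I.next st g fk fkp =
        ⟨I.trial st g, I.γ⁻¹ * st.α, I.newMem st g, some (st.x, g)⟩ := by
      unfold next; rw [if_pos hacc]
    rw [hnext] at hx' ⊢
    simp only at hx' ⊢
    have hdec := trial_le_of_accept hE hEp hacc
    refine ⟨j + 1, ?_, ?_⟩
    · rw [hj, neg_add, zpow_add₀ hγ0.ne', zpow_neg_one]; ring
    -- without using accuracy, the gap grows at most by the noise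
    have hgen : Real.log ((φ (I.trial st g) - φstar) / ε) ≤ Real.log ((φ st.x - φstar) / ε) +
        Real.log (1 + (2 * I.εf + (E + Ep)) / ε) := by
      have hY : 0 ≤ (2 * I.εf + (E + Ep)) / ε := by positivity
      have hΦ : 0 < φ st.x - φstar := hε0.trans hx
      rw [← Real.log_mul (div_pos hΦ hε0).ne' (by positivity)]
      refine Real.log_le_log (div_pos (hε0.trans hx') hε0) ?_
      rw [div_mul_eq_mul_div]
      refine div_le_div_of_nonneg_right ?_ hε0.le
      have h1 : 2 * I.εf + (E + Ep) ≤ (φ st.x - φstar) * ((2 * I.εf + (E + Ep)) / ε) := by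
        rw [mul_div_assoc', le_div_iff₀ hε0, mul_comm]; gcongr
      have h2 : 0 ≤ st.α * I.θ * inner ℝ (I.dir st g) g := by positivity
      linarith
    have habs : |((j + 1 : ℤ) : ℝ)| ≤ |(j : ℝ)| + 1 := by
      push_cast
      exact (abs_add_le _ _).trans (by rw [abs_one])
    have habs' := mul_le_mul_of_nonneg_left habs hh.le
    by_cases hJ' : J
    · rw [if_pos hJ']
      obtain ⟨hg, hEE⟩ := hJ hJ'
      by_cases hj0 : 0 ≤ j
      · have hαle : αbar ≤ st.α := by
          rw [hj]
          refine le_mul_of_one_le_right hT.pos.le ?_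
          rw [zpow_neg]
          exact (one_le_inv₀ (zpow_pos hγ0 _)).2 (zpow_le_one₀ hγ0 hγ1.le hj0)
        have hPL := hconv.two_mul_le_norm_gradient_sq hstar st.x
        have hσ := hI.σlb_pos
        have hβ := hconv.1
        have hpred : αbar * I.θ * (I.σlb * ‖g‖ ^ 2) ≤ st.α * I.θ * inner ℝ (I.dir st g) g := by
          have := (hI.dir_bounds hst g).1
          gcongr
        -- the contraction factor comes from whichever accuracy bound is active
        have hstrong : ∀ c : ℝ, 0 < c → c ≤ 1 → c * ‖gradient φ st.x‖ ^ 2 ≤ ‖g‖ ^ 2 →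
            Real.log ((φ (I.trial st g) - φstar) / ε) ≤ Real.log ((φ st.x - φstar) / ε) +
            Real.log (1 + (2 * I.εf + (E + Ep)) / ε) +
              Real.log (1 - αbar * I.σlb * I.θ * β * c) := by
          intro c hc0 hc1 hcg
          have hq := hT.contraction_le
          have hq0 : 0 ≤ αbar * I.σlb * I.θ * β := by have := hT.pos; positivity
          refine log_gap_le hε0 hx.le (hε0.trans hx') hr0 (by linarith) (by positivity)
            (by nlinarith) ?_
          have h1 : αbar * I.θ * I.σlb * (c * (2 * β * (φ st.x - φstar))) ≤
              αbar * I.θ * I.σlb * ‖g‖ ^ 2 := by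
            have := hT.pos
            refine mul_le_mul_of_nonneg_left ?_ (by positivity)
            exact (mul_le_mul_of_nonneg_left hPL hc0.le).trans hcg
          linarith
        have hmain : Real.log ((φ (I.trial st g) - φstar) / ε) ≤
            Real.log ((φ st.x - φstar) / ε) +
            Real.log (1 + (2 * I.εf + (E + Ep)) / ε) - h := by
          rcases hg.relative hconv hstar hT.η_pos hT.η_lt hε hx with ⟨-, h1⟩ | ⟨-, h1⟩
          · have h2 := hstrong (1 / (1 + τ) ^ 2) (by positivity)
              (by rw [div_le_one (by positivity)]; nlinarith)
              (by rw [one_div, inv_mul_le_iff₀ (by positivity), ← mul_pow]; gcongr)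
            have h3 : h ≤ -Real.log (1 - αbar * I.σlb * I.θ * β / (1 + τ) ^ 2) := min_le_left _ _
            rw [mul_one_div] at h2
            linarith
          · have hη := hT.η_lt
            have hη0 := hT.η_pos
            have h2 := hstrong ((1 - η) ^ 2) (by have : 0 < 1 - η := by linarith
                                                 positivity) (by nlinarith)
              (by rw [← mul_pow]
                  exact pow_le_pow_left₀ (mul_nonneg (by linarith) (norm_nonneg _)) h1 2)
            have h3 : h ≤ -Real.log (1 - αbar * I.σlb * β * I.θ * (1 - η) ^ 2) := min_le_right _ _
            have h4 : αbar * I.σlb * β * I.θ * (1 - η) ^ 2 = αbar * I.σlb * I.θ * β * (1 - η) ^ 2 := by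
              ring
            rw [h4] at h3
            linarith
        linarith
      · have h1 : |((j + 1 : ℤ) : ℝ)| = |(j : ℝ)| - 1 := by
          have h2 : ((j + 1 : ℤ) : ℝ) ≤ 0 := by exact_mod_cast (by omega : j + 1 ≤ 0)
          have h3 : (j : ℝ) ≤ 0 := by exact_mod_cast (by omega : j ≤ 0)
          rw [abs_of_nonpos h2, abs_of_nonpos h3]; push_cast; ring
        rw [h1]
        linarith
    · rw [if_neg hJ']
      linarith
  · have hnext : I.next st g fk fkp = ⟨st.x, I.γ * st.α, I.newMem st g, st.prev⟩ := by
      unfold next; rw [if_neg hacc]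
    rw [hnext]
    simp only
    refine ⟨j - 1, ?_, ?_⟩
    · rw [hj, neg_sub, sub_eq_add_neg, zpow_add₀ hγ0.ne', zpow_one]; ring
    by_cases hJ' : J
    · rw [if_pos hJ']
      obtain ⟨hg, hEE⟩ := hJ hJ'
      have hj1 : 1 ≤ j := by
        by_contra hcon
        refine hacc ?_
        have hαle : st.α ≤ αbar := by
          rw [hj]
          exact mul_le_of_le_one_right hT.pos.le
            (zpow_le_one₀ hγ0 hγ1.le (by omega))
        have h1 := hT.sufficient_decrease hI hdiff hLip hconv hstar hκ hε hst hα hαle hx hg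
        have h2 := abs_le.1 hE
        have h3 := abs_le.1 hEp
        linarith
      have h1 : |((j - 1 : ℤ) : ℝ)| = |(j : ℝ)| - 1 := by
        have h2 : (0 : ℝ) ≤ ((j - 1 : ℤ) : ℝ) := by exact_mod_cast (by omega : 0 ≤ j - 1)
        have h3 : (0 : ℝ) ≤ (j : ℝ) := by exact_mod_cast (by omega : 0 ≤ j)
        rw [abs_of_nonneg h2, abs_of_nonneg h3]; push_cast; ring
      rw [h1]
      linarith
    · rw [if_neg hJ']
      have habs : |((j - 1 : ℤ) : ℝ)| ≤ |(j : ℝ)| + 1 := by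
        push_cast
        exact (abs_sub _ _).trans (by rw [abs_one])
      have habs' := mul_le_mul_of_nonneg_left habs hh.le
      linarith

end Step

end QSASSInput

/-! ### Measurability of the algorithm -/

/-- The product σ-algebra on matrices, which is also their Borel σ-algebra. -/
instance {n : ℕ} : MeasurableSpace (Matrix (Fin n) (Fin n) ℝ) :=
  inferInstanceAs (MeasurableSpace (Fin n → Fin n → ℝ))

instance {n : ℕ} : BorelSpace (Matrix (Fin n) (Fin n) ℝ) :=
  inferInstanceAs (BorelSpace (Fin n → Fin n → ℝ))

lemma Measurable.of_entries {Ω : Type*} [MeasurableSpace Ω] {n : ℕ}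
    {B : Ω → Matrix (Fin n) (Fin n) ℝ} (h : ∀ i j, Measurable fun ω => B ω i j) : Measurable B :=
  measurable_pi_iff.2 fun i => measurable_pi_iff.2 fun j => h i j

lemma Measurable.entry {Ω : Type*} [MeasurableSpace Ω] {n : ℕ}
    {B : Ω → Matrix (Fin n) (Fin n) ℝ} (h : Measurable B) (i j : Fin n) :
    Measurable fun ω => B ω i j :=
  measurable_pi_iff.1 (measurable_pi_iff.1 h i) j

lemma Measurable.vec_apply {Ω : Type*} [MeasurableSpace Ω] {n : ℕ} {v : Ω → Vec n}
    (h : Measurable v) (i : Fin n) : Measurable fun ω => (v ω).ofLp i :=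
  (measurable_pi_iff.1 ((WithLp.measurable_ofLp 2 (Fin n → ℝ)).comp h)) i

lemma measurable_bfgsUpdate {n : ℕ} :
    Measurable fun q : Matrix (Fin n) (Fin n) ℝ × (Vec n × Vec n) =>
      bfgsUpdate q.1 q.2.1 q.2.2 := by
  refine Measurable.of_entries fun i j => ?_
  have hB : ∀ i j, Measurable fun q : Matrix (Fin n) (Fin n) ℝ × (Vec n × Vec n) => q.1 i j :=
    fun i j => measurable_fst.entry i j
  have hs : ∀ i, Measurable fun q : Matrix (Fin n) (Fin n) ℝ × (Vec n × Vec n) => q.2.1.ofLp i :=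
    fun i => (measurable_fst.comp measurable_snd).vec_apply i
  have hy : ∀ i, Measurable fun q : Matrix (Fin n) (Fin n) ℝ × (Vec n × Vec n) => q.2.2.ofLp i :=
    fun i => (measurable_snd.comp measurable_snd).vec_apply i
  simp only [bfgsUpdate, Matrix.add_apply, Matrix.sub_apply, Matrix.smul_apply,
    Matrix.vecMulVec_apply, Matrix.mulVec, Matrix.vecMul, dotProduct, smul_eq_mul]
  fun_prop

/-- The set of matrices that pass the spectral safeguard is Borel. -/
lemma measurableSet_spectrum_mem_Ioo (n : ℕ) (lb ub : ℝ) :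
    MeasurableSet {B : Matrix (Fin n) (Fin n) ℝ | ∀ μ ∈ spectrum ℝ B, lb < μ ∧ μ < ub} := by
  -- the complement is a countable union of projections of closed sets along compact sets
  have hspec : ∀ (B : Matrix (Fin n) (Fin n) ℝ) (μ : ℝ),
      μ ∈ spectrum ℝ B ↔ (μ • (1 : Matrix (Fin n) (Fin n) ℝ) - B).det = 0 := by
    intro B μ
    rw [spectrum.mem_iff, Matrix.isUnit_iff_isUnit_det, isUnit_iff_ne_zero, not_not,
      Algebra.algebraMap_eq_smul_one]
  have hcompl : {B : Matrix (Fin n) (Fin n) ℝ | ∀ μ ∈ spectrum ℝ B, lb < μ ∧ μ < ub}ᶜ =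
      ⋃ N : ℕ, Prod.fst '' {q : Matrix (Fin n) (Fin n) ℝ × Set.Icc (-(N : ℝ)) N |
        ((q.2 : ℝ) • (1 : Matrix (Fin n) (Fin n) ℝ) - q.1).det = 0 ∧
          (q.2 : ℝ) ∈ (Set.Ioo lb ub)ᶜ} := by
    ext B
    simp only [Set.mem_compl_iff, Set.mem_ofPred_eq, not_forall, Set.mem_iUnion, Set.mem_image,
      Prod.exists, exists_and_right, exists_eq_right, exists_prop]
    constructor
    · rintro ⟨μ, hμ, hn⟩
      obtain ⟨N, hN⟩ := exists_nat_ge |μ|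
      exact ⟨N, ⟨μ, abs_le.1 hN⟩, (hspec B μ).1 hμ, hn⟩
    · rintro ⟨N, μ, hμ, hn⟩
      exact ⟨μ, (hspec B μ).2 hμ, hn⟩
  rw [← MeasurableSet.compl_iff, hcompl]
  refine MeasurableSet.iUnion fun N => IsClosed.measurableSet ?_
  refine isClosedMap_fst_of_compactSpace _ (IsClosed.inter ?_ ?_)
  · refine isClosed_eq ?_ continuous_const
    fun_prop
  · exact (isOpen_Ioo.isClosed_compl).preimage (by fun_prop)

/-- Measurability of a list-valued map: its length and its entries (`0` beyond the end) are
measurable. -/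
def MeasurableList {Ω α : Type*} [MeasurableSpace Ω] [MeasurableSpace α] [Zero α]
    (l : Ω → List α) : Prop :=
  (Measurable fun ω => (l ω).length) ∧ ∀ i, Measurable fun ω => (l ω).getD i 0

/-- Evaluating a sequence of measurable maps at a measurable random index is measurable. -/
lemma Measurable.countable_eval {Ω β : Type*} [MeasurableSpace Ω] [MeasurableSpace β]
    {N : Ω → ℕ} {F : ℕ → Ω → β} (hN : Measurable N) (hF : ∀ k, Measurable (F k)) :
    Measurable fun ω => F (N ω) ω :=
  (measurable_from_prod_countable_right (f := fun q : ℕ × Ω => F q.1 q.2) hF).comp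
    (hN.prodMk measurable_id)

namespace MeasurableList

variable {Ω α β : Type*} [MeasurableSpace Ω] [MeasurableSpace α] [MeasurableSpace β] [Zero α]
  {l l' : Ω → List α}

lemma const (l : List α) : MeasurableList fun _ : Ω => l :=
  ⟨measurable_const, fun _ => measurable_const⟩

lemma tail (hl : MeasurableList l) : MeasurableList fun ω => (l ω).tail := by
  refine ⟨?_, fun i => ?_⟩
  · simp only [List.length_tail]
    exact (measurable_from_top (f := fun k : ℕ => k - 1)).comp hl.1
  · have : ∀ ω, (l ω).tail.getD i 0 = (l ω).getD (i + 1) 0 := by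
      intro ω; cases l ω <;> simp
    simp only [this]
    exact hl.2 _

lemma append_singleton (hl : MeasurableList l) {a : Ω → α} (ha : Measurable a) :
    MeasurableList fun ω => l ω ++ [a ω] := by
  refine ⟨?_, fun i => ?_⟩
  · simp only [List.length_append, List.length_singleton]
    exact (measurable_from_top (f := fun k : ℕ => k + 1)).comp hl.1
  · have : ∀ ω, (l ω ++ [a ω]).getD i 0 =
        if i < (l ω).length then (l ω).getD i 0 else if (l ω).length = i then a ω else 0 := by
      intro ω
      split_ifs with h1 h2
      · exact List.getD_append _ _ _ _ h1
      · rw [List.getD_append_right _ _ _ _ (not_lt.1 h1)]; simp [h2]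
      · rw [List.getD_eq_default]
        simp only [List.length_append, List.length_singleton]; omega
    simp only [this]
    exact Measurable.ite (hl.1 measurableSet_Ioi) (hl.2 i)
      (Measurable.ite (hl.1 (measurableSet_singleton i)) ha measurable_const)

lemma ite {p : Ω → Prop} [DecidablePred p] (hp : MeasurableSet {ω | p ω})
    (hl : MeasurableList l) (hl' : MeasurableList l') :
    MeasurableList fun ω => if p ω then l ω else l' ω := by
  refine ⟨?_, fun i => ?_⟩
  · simp only [apply_ite List.length]
    exact Measurable.ite hp hl.1 hl'.1
  · simp only [apply_ite (fun l : List α => l.getD i 0)]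
    exact Measurable.ite hp (hl.2 i) (hl'.2 i)

lemma countable_eval {N : Ω → ℕ} {F : ℕ → Ω → List α} (hN : Measurable N)
    (hF : ∀ k, MeasurableList (F k)) : MeasurableList fun ω => F (N ω) ω :=
  ⟨hN.countable_eval fun k => (hF k).1, fun i => hN.countable_eval fun k => (hF k).2 i⟩

lemma foldl (hl : MeasurableList l) {f : β → α → β} (hf : Measurable (Function.uncurry f))
    (b : β) : Measurable fun ω => (l ω).foldl f b := by
  have htake : ∀ k, Measurable fun ω => ((l ω).take k).foldl f b := by
    intro k
    induction k with
    | zero => simp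
    | succ k ih =>
      have : ∀ ω, ((l ω).take (k + 1)).foldl f b =
          if k < (l ω).length then Function.uncurry f (((l ω).take k).foldl f b, (l ω).getD k 0)
          else ((l ω).take k).foldl f b := by
        intro ω
        split_ifs with h
        · rw [List.take_succ_eq_append_getElem h, List.foldl_append, List.getD_eq_getElem _ _ h]
          rfl
        · rw [List.take_of_length_le (by omega), List.take_of_length_le (by omega)]
      simp only [this]
      exact Measurable.ite (hl.1 measurableSet_Ioi) (hf.comp (ih.prodMk (hl.2 k))) ih
  have := hl.1.countable_eval htake
  simpa using this

end MeasurableList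

section

variable {Ω : Type*} [MeasurableSpace Ω] {n : ℕ}

lemma MeasurableList.lbfgsMatrix {l : Ω → List (Vec n × Vec n)} (hl : MeasurableList l) (c : ℝ) :
    Measurable fun ω => lbfgsMatrix c (l ω) :=
  hl.foldl (f := fun B (sy : Vec n × Vec n) => bfgsUpdate B sy.1 sy.2) measurable_bfgsUpdate _

lemma MeasurableList.enforceSpectrum {l : Ω → List (Vec n × Vec n)} (hl : MeasurableList l)
    (c lb ub : ℝ) : MeasurableList fun ω => enforceSpectrum c lb ub (l ω) := by
  classical
  -- lists of length more than `k` are cut off so that the recursion has bounded depth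
  have key : ∀ k : ℕ, ∀ {l : Ω → List (Vec n × Vec n)}, MeasurableList l →
      MeasurableList fun ω => if (l ω).length ≤ k then _root_.enforceSpectrum c lb ub (l ω)
        else [] := by
    intro k
    induction k with
    | zero =>
      intro l _
      have : ∀ ω, (if (l ω).length ≤ 0 then _root_.enforceSpectrum c lb ub (l ω) else []) = [] := by
        intro ω
        split_ifs with h
        · rw [List.length_eq_zero_iff.1 (Nat.le_zero.1 h), _root_.enforceSpectrum]
        · rfl
      simp only [this]
      exact const _
    | succ k ih =>
      intro l hl
      have : ∀ ω, (if (l ω).length ≤ k + 1 then _root_.enforceSpectrum c lb ub (l ω) else []) =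
          if (l ω).length ≤ k + 1 then
            if (l ω).length = 0 then [] else
            if ∀ μ ∈ spectrum ℝ (_root_.lbfgsMatrix c (l ω)), lb < μ ∧ μ < ub then l ω
            else if (l ω).tail.length ≤ k then
              _root_.enforceSpectrum c lb ub (l ω).tail else []
          else [] := by
        intro ω
        cases h : l ω with
        | nil => simp [_root_.enforceSpectrum]
        | cons a m =>
          simp only [List.length_cons, List.tail_cons, Nat.add_le_add_iff_right,
            Nat.add_eq_zero_iff, one_ne_zero, and_false, if_false]
          split_ifs with h1 h2 <;> simp_all [_root_.enforceSpectrum]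
      simp only [this]
      exact ite (hl.1 measurableSet_Iic) (ite (hl.1 (measurableSet_singleton 0)) (const _)
        (ite (hl.lbfgsMatrix c (measurableSet_spectrum_mem_Ioo n lb ub)) hl (ih hl.tail)))
        (const _)
  have := countable_eval hl.1 (fun k => key k hl)
  simpa using this

/-- Measurability of a map into the states of the algorithm, componentwise. -/
structure MeasurableState (st : Ω → QSASSState n) : Prop where
  x : Measurable fun ω => (st ω).x
  α : Measurable fun ω => (st ω).α
  mem : MeasurableList fun ω => (st ω).mem
  isSome : MeasurableSet {ω | (st ω).prev.isSome}
  prev : Measurable fun ω => (st ω).prev.getD 0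

lemma MeasurableState.mono {Ω : Type*} {m m' : MeasurableSpace Ω} (h : m ≤ m')
    {st : Ω → QSASSState n} (hst : @MeasurableState Ω m n st) : @MeasurableState Ω m' n st := by
  obtain ⟨hx, hα, ⟨hlen, hget⟩, hsome, hprev⟩ := hst
  exact ⟨hx.mono h le_rfl, hα.mono h le_rfl,
    ⟨hlen.mono h le_rfl, fun i => (hget i).mono h le_rfl⟩, h _ hsome, hprev.mono h le_rfl⟩

lemma MeasurableState.newMem {st : Ω → QSASSState n} (hst : MeasurableState st)
    (I : QSASSInput n) {g : Ω → Vec n} (hg : Measurable g) :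
    MeasurableList fun ω => I.newMem (st ω) (g ω) := by
  classical
  have : ∀ ω, I.newMem (st ω) (g ω) = if (st ω).prev.isSome then
      enforceSpectrum I.c I.lbB I.ubB
        (if I.θip < inner ℝ ((st ω).x - ((st ω).prev.getD 0).1) (g ω - ((st ω).prev.getD 0).2) then
          (if (st ω).mem.length = I.M then (st ω).mem.tail else (st ω).mem) ++
            [((st ω).x - ((st ω).prev.getD 0).1, g ω - ((st ω).prev.getD 0).2)]
        else (st ω).mem) else (st ω).mem := by
    intro ω
    unfold QSASSInput.newMem
    split <;> rename_i h <;> simp [h]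
  simp only [this]
  have hs : Measurable fun ω => (st ω).x - ((st ω).prev.getD 0).1 := hst.x.sub hst.prev.fst
  have hy : Measurable fun ω => g ω - ((st ω).prev.getD 0).2 := hg.sub hst.prev.snd
  refine .ite hst.isSome (.enforceSpectrum (.ite ?_ (.append_singleton (.ite ?_ hst.mem.tail
    hst.mem) (hs.prodMk hy)) hst.mem) _ _ _) hst.mem
  · exact measurableSet_lt measurable_const (hs.inner hy)
  · exact hst.mem.1 (measurableSet_singleton I.M)

lemma Measurable.inv_mulVec {B : Ω → Matrix (Fin n) (Fin n) ℝ} (hB : Measurable B)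
    {g : Ω → Vec n} (hg : Measurable g) :
    Measurable fun ω => (WithLp.toLp 2 ((B ω)⁻¹.mulVec (g ω).ofLp) : Vec n) := by
  refine (WithLp.measurable_toLp 2 (Fin n → ℝ)).comp (measurable_pi_iff.2 fun i => ?_)
  have hdet : Measurable fun ω => (B ω).det :=
    (Continuous.matrix_det continuous_id).measurable.comp hB
  have hadj : ∀ i j, Measurable fun ω => (B ω).adjugate i j := fun i j =>
    ((Continuous.matrix_adjugate continuous_id).measurable.comp hB).entry i j
  have hg' : ∀ i, Measurable fun ω => (g ω).ofLp i := fun i => hg.vec_apply i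
  simp only [Matrix.inv_def, Ring.inverse_eq_inv', Matrix.mulVec, dotProduct, Matrix.smul_apply,
    smul_eq_mul]
  fun_prop

lemma MeasurableState.dir {st : Ω → QSASSState n} (hst : MeasurableState st)
    (I : QSASSInput n) {g : Ω → Vec n} (hg : Measurable g) :
    Measurable fun ω => I.dir (st ω) (g ω) :=
  ((hst.newMem I hg).lbfgsMatrix I.c).inv_mulVec hg

lemma MeasurableState.trial {st : Ω → QSASSState n} (hst : MeasurableState st)
    (I : QSASSInput n) {g : Ω → Vec n} (hg : Measurable g) :
    Measurable fun ω => I.trial (st ω) (g ω) :=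
  hst.x.sub (hst.α.smul (hst.dir I hg))

lemma MeasurableState.next {st : Ω → QSASSState n} (hst : MeasurableState st)
    (I : QSASSInput n) {g : Ω → Vec n} (hg : Measurable g) {f fp : Ω → ℝ} (hf : Measurable f)
    (hfp : Measurable fp) : MeasurableState fun ω => I.next (st ω) (g ω) (f ω) (fp ω) := by
  have hacc : MeasurableSet {ω | fp ω ≤ f ω - (st ω).α * I.θ *
      inner ℝ (I.dir (st ω) (g ω)) (g ω) + 2 * I.εf} :=
    measurableSet_le hfp
      ((hf.sub ((hst.α.mul_const _).mul ((hst.dir I hg).inner hg))).add_const _)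
  unfold QSASSInput.next
  constructor
  · simp only [apply_ite QSASSState.x]
    exact Measurable.ite hacc (hst.trial I hg) hst.x
  · simp only [apply_ite QSASSState.α]
    exact Measurable.ite hacc (hst.α.const_mul _) (hst.α.const_mul _)
  · simp only [apply_ite QSASSState.mem, ite_self]
    exact hst.newMem I hg
  · have : {ω | (if fp ω ≤ f ω - (st ω).α * I.θ * inner ℝ (I.dir (st ω) (g ω)) (g ω) + 2 * I.εf
        then (⟨I.trial (st ω) (g ω), I.γ⁻¹ * (st ω).α, I.newMem (st ω) (g ω),
          some ((st ω).x, g ω)⟩ : QSASSState n)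
        else ⟨(st ω).x, I.γ * (st ω).α, I.newMem (st ω) (g ω), (st ω).prev⟩).prev.isSome} =
        {ω | fp ω ≤ f ω - (st ω).α * I.θ * inner ℝ (I.dir (st ω) (g ω)) (g ω) + 2 * I.εf} ∪
          {ω | (st ω).prev.isSome} := by
      ext ω
      simp only [Set.mem_ofPred_eq, Set.mem_union]
      split_ifs with h <;> simp [h]
    rw [this]
    exact hacc.union hst.isSome
  · simp only [apply_ite QSASSState.prev, apply_ite (fun o : Option (Vec n × Vec n) => o.getD 0),
      Option.getD_some]
    exact Measurable.ite hacc (hst.x.prodMk hg) hst.prev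

end

section Adapted

variable {n : ℕ} {S₀ S₁ Ω : Type*} [MeasurableSpace S₀] [MeasurableSpace S₁]
  {ξg : ℕ → Ω → S₁} {ξ ξp : ℕ → Ω → S₀}

lemma comap_le_qsassPast {j k : ℕ} (h : j < k) :
    MeasurableSpace.comap (ξg j) inferInstance ⊔ MeasurableSpace.comap (ξ j) inferInstance ⊔
      MeasurableSpace.comap (ξp j) inferInstance ≤ qsassPast ξg ξ ξp k :=
  le_iSup (fun j : Fin k => MeasurableSpace.comap (ξg j) inferInstance ⊔
    MeasurableSpace.comap (ξ j) inferInstance ⊔ MeasurableSpace.comap (ξp j) inferInstance) ⟨j, h⟩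

lemma qsassPast_mono {j k : ℕ} (h : j ≤ k) : qsassPast ξg ξ ξp j ≤ qsassPast ξg ξ ξp k :=
  iSup_le fun i => comap_le_qsassPast (i.2.trans_le h)

lemma measurable_ξg_past {j k : ℕ} (h : j < k) : Measurable[qsassPast ξg ξ ξp k] (ξg j) :=
  Measurable.mono (comap_measurable _)
    ((le_sup_left.trans le_sup_left).trans (comap_le_qsassPast h)) le_rfl

lemma measurable_ξ_past {j k : ℕ} (h : j < k) : Measurable[qsassPast ξg ξ ξp k] (ξ j) :=
  Measurable.mono (comap_measurable _)
    ((le_sup_right.trans le_sup_left).trans (comap_le_qsassPast h)) le_rfl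

lemma measurable_ξp_past {j k : ℕ} (h : j < k) : Measurable[qsassPast ξg ξ ξp k] (ξp j) :=
  Measurable.mono (comap_measurable _) (le_sup_right.trans (comap_le_qsassPast h)) le_rfl

lemma FirstOracle.measurable_comp (O₁ : FirstOracle n S₁) [MeasurableSpace Ω] {x : Ω → Vec n}
    {α : Ω → ℝ} {ζ : Ω → S₁} (hx : Measurable x) (hα : Measurable α) (hζ : Measurable ζ) :
    Measurable fun ω => O₁.g (x ω) (α ω) (ζ ω) :=
  O₁.measurable_g.comp ((hx.prodMk hα).prodMk hζ)

lemma ZerothOracle.measurable_comp (O₀ : ZerothOracle n S₀) [MeasurableSpace Ω] {x : Ω → Vec n}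
    {ζ : Ω → S₀} (hx : Measurable x) (hζ : Measurable ζ) : Measurable fun ω => O₀.f (x ω) (ζ ω) :=
  O₀.measurable_f.comp (hx.prodMk hζ)

lemma ZerothOracle.measurable_err (O₀ : ZerothOracle n S₀) {φ : Vec n → ℝ} (hφ : Measurable φ) :
    Measurable fun q : Vec n × S₀ => O₀.err φ q.1 q.2 := by
  have := O₀.measurable_comp (x := fun q : Vec n × S₀ => q.1) measurable_fst measurable_snd
  have h : Measurable fun q : Vec n × S₀ => |O₀.f q.1 q.2 - φ q.1| := by
    fun_prop
  exact h

/-- The state at the beginning of iteration `k` is determined measurably by the past. -/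
lemma measurableState_qsassState (I : QSASSInput n) (O₀ : ZerothOracle n S₀)
    (O₁ : FirstOracle n S₁) (k : ℕ) :
    @MeasurableState Ω (qsassPast ξg ξ ξp k) n (qsassState I O₀ O₁ ξg ξ ξp k) := by
  induction k with
  | zero =>
    let _ := qsassPast ξg ξ ξp 0
    exact ⟨measurable_const, measurable_const, MeasurableList.const _,
      MeasurableSet.const (I.init.prev.isSome = true), measurable_const⟩
  | succ k ih =>
    have ih' := ih.mono (qsassPast_mono k.le_succ)
    have h1 := measurable_ξg_past (ξg := ξg) (ξ := ξ) (ξp := ξp) k.lt_succ_self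
    have h2 := measurable_ξ_past (ξg := ξg) (ξ := ξ) (ξp := ξp) k.lt_succ_self
    have h3 := measurable_ξp_past (ξg := ξg) (ξ := ξ) (ξp := ξp) k.lt_succ_self
    let _ := qsassPast ξg ξ ξp (k + 1)
    have hg := O₁.measurable_comp ih'.x ih'.α h1
    exact ih'.next I hg (O₀.measurable_comp ih'.x h2) (O₀.measurable_comp (ih'.trial I hg) h3)

end Adapted

/-! ### Conditional laws and concentration -/

section Conditional

variable {Ω : Type*} {m mΩ : MeasurableSpace Ω} {P : Measure Ω} [IsProbabilityMeasure P]

/-- If `ζ` has conditional law `κ (X ·)` given `m` and `X` is `m`-measurable, then `X` may be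
frozen when integrating a function of `(X, ζ)` over a set of `m`. -/
lemma setLIntegral_comp_eq_of_condLaw (hm : m ≤ mΩ) {E S : Type*} [MeasurableSpace E]
    [MeasurableSpace S] {X : Ω → E} {ζ : Ω → S} {κ : Kernel E S} [IsMarkovKernel κ]
    (hX : Measurable[m] X) (hζ : Measurable ζ)
    (hlaw : ∀ B, MeasurableSet B → P⟦ζ ⁻¹' B | m⟧ =ᵐ[P] fun ω => (κ (X ω)).real B)
    {F : E × S → ℝ≥0∞} (hF : Measurable F) {A : Set Ω} (hA : MeasurableSet[m] A) :
    ∫⁻ ω in A, F (X ω, ζ ω) ∂P = ∫⁻ ω in A, ∫⁻ s, F (X ω, s) ∂(κ (X ω)) ∂P := by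
  have hX' : Measurable X := hX.mono hm le_rfl
  have hmap : (P.restrict A).map (fun ω => (X ω, ζ ω)) = ((P.restrict A).map X) ⊗ₘ κ := by
    refine Measure.ext_prod fun {U B} hU hB => ?_
    have hC : MeasurableSet[m] (X ⁻¹' U ∩ A) := (hX hU).inter hA
    rw [Measure.map_apply (hX'.prodMk hζ) (hU.prod hB), Measure.compProd_apply_prod hU hB,
      setLIntegral_map hU (κ.measurable_coe hB) hX', Measure.restrict_restrict (hX' hU),
      Measure.restrict_apply ((hX'.prodMk hζ) (hU.prod hB))]
    have h1 : ∫ ω in X ⁻¹' U ∩ A, (κ (X ω)).real B ∂P = P.real (ζ ⁻¹' B ∩ (X ⁻¹' U ∩ A)) := by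
      rw [← setIntegral_congr_ae (hm _ hC) ((hlaw B hB).mono fun ω h _ => h),
        setIntegral_condExp hm ((integrable_const (1 : ℝ)).indicator (hζ hB)) hC,
        setIntegral_indicator (hζ hB), setIntegral_const, smul_eq_mul, mul_one, Set.inter_comm]
    have h2 : ∫⁻ ω in X ⁻¹' U ∩ A, κ (X ω) B ∂P = P (ζ ⁻¹' B ∩ (X ⁻¹' U ∩ A)) := by
      have hmeas : Measurable fun ω => κ (X ω) B := (κ.measurable_coe hB).comp hX'
      rw [← ENNReal.toReal_eq_toReal_iff' _ (measure_ne_top _ _), ← measureReal_def, ← h1,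
        ← integral_toReal hmeas.aemeasurable (Filter.Eventually.of_forall fun ω =>
          measure_lt_top _ _)]
      · rfl
      · refine (lt_of_le_of_lt (lintegral_mono fun ω => prob_le_one) ?_).ne
        simp
    rw [h2]
    congr 1
    ext ω
    simp only [Set.mem_inter_iff, Set.mem_preimage, Set.mem_prod]
    tauto
  have h3 : ∫⁻ ω in A, F (X ω, ζ ω) ∂P =
      ∫⁻ q, F q ∂((P.restrict A).map (fun ω => (X ω, ζ ω))) :=
    (lintegral_map hF (hX'.prodMk hζ)).symm
  have h4 : Measurable fun x => ∫⁻ s, F (x, s) ∂(κ x) := hF.lintegral_kernel_prod_right'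
  rw [h3, hmap, Measure.lintegral_compProd hF, lintegral_map h4 hX']

/-- A conditional upper bound for the integrals of the sections bounds the integral. -/
lemma setLIntegral_comp_le_of_condLaw (hm : m ≤ mΩ) {E S : Type*} [MeasurableSpace E]
    [MeasurableSpace S] {X : Ω → E} {ζ : Ω → S} {κ : Kernel E S} [IsMarkovKernel κ]
    (hX : Measurable[m] X) (hζ : Measurable ζ)
    (hlaw : ∀ B, MeasurableSet B → P⟦ζ ⁻¹' B | m⟧ =ᵐ[P] fun ω => (κ (X ω)).real B)
    {F : E × S → ℝ≥0∞} (hF : Measurable F) {A : Set Ω} (hA : MeasurableSet[m] A)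
    {C : ℝ≥0∞} (hC : ∀ x, ∫⁻ s, F (x, s) ∂(κ x) ≤ C) :
    ∫⁻ ω in A, F (X ω, ζ ω) ∂P ≤ C * P A := by
  rw [setLIntegral_comp_eq_of_condLaw hm hX hζ hlaw hF hA, ← setLIntegral_const]
  exact lintegral_mono fun ω => hC _

/-- A lower bound for the conditional probability of `J` given `m`, tested on the sets of `m`,
extends to nonnegative bounded `m`-measurable weights. -/
lemma mul_integral_le_setIntegral (hm : m ≤ mΩ) {J : Set Ω} {p : ℝ}
    (hp : 0 ≤ p) (h : ∀ A, MeasurableSet[m] A → p * P.real A ≤ P.real (A ∩ J)) {w : Ω → ℝ}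
    (hw : Measurable[m] w) (hw0 : ∀ ω, 0 ≤ w ω) (hw1 : ∀ ω, w ω ≤ 1) :
    p * ∫ ω, w ω ∂P ≤ ∫ ω in J, w ω ∂P := by
  have hwi : Integrable w P := Integrable.of_bound (hw.mono hm le_rfl).aestronglyMeasurable 1
    (Filter.Eventually.of_forall fun ω => by rw [Real.norm_of_nonneg (hw0 ω)]; exact hw1 ω)
  have hle : ENNReal.ofReal p • P.trim hm ≤ (P.restrict J).trim hm := by
    refine Measure.le_iff.2 fun A hA => ?_
    rw [Measure.smul_apply, smul_eq_mul, trim_measurableSet_eq hm hA, trim_measurableSet_eq hm hA,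
      Measure.restrict_apply (hm _ hA)]
    rw [← ofReal_measureReal, ← ofReal_measureReal, ← ENNReal.ofReal_mul hp]
    exact ENNReal.ofReal_le_ofReal (h A hA)
  have h1 : ENNReal.ofReal p * ∫⁻ ω, ENNReal.ofReal (w ω) ∂P ≤
      ∫⁻ ω in J, ENNReal.ofReal (w ω) ∂P := by
    have hwm : Measurable[m] fun ω => ENNReal.ofReal (w ω) := hw.ennreal_ofReal
    rw [← lintegral_trim hm hwm, ← lintegral_trim hm hwm, ← smul_eq_mul,
      ← lintegral_smul_measure]
    exact lintegral_mono' hle le_rfl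
  rw [← ofReal_integral_eq_lintegral_ofReal hwi (Filter.Eventually.of_forall hw0),
    ← ofReal_integral_eq_lintegral_ofReal hwi.restrict (Filter.Eventually.of_forall hw0),
    ← ENNReal.ofReal_mul hp] at h1
  exact (ENNReal.ofReal_le_ofReal_iff (integral_nonneg hw0)).1 h1

end Conditional

/-- Hoeffding's lemma for a Bernoulli variable. -/
lemma one_sub_add_mul_exp_neg_le {p : ℝ} (hp0 : 0 ≤ p) (hp1 : p ≤ 1) (l : ℝ) :
    1 - p + p * Real.exp (-l) ≤ Real.exp (-(l * p) + l ^ 2 / 8) := by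
  set μ : Measure ℝ := ENNReal.ofReal (1 - p) • Measure.dirac 0 + ENNReal.ofReal p • Measure.dirac 1
    with hμ
  have hprob : IsProbabilityMeasure μ := by
    constructor
    simp only [hμ, Measure.add_apply, Measure.smul_apply, measure_univ, smul_eq_mul, mul_one]
    rw [← ENNReal.ofReal_add (by linarith) hp0]
    simp
  have hint : ∀ f : ℝ → ℝ, Measurable f → ∫ x, f x ∂μ = (1 - p) * f 0 + p * f 1 := by
    intro f hf
    have hi : ∀ a : ℝ, Integrable f (Measure.dirac a) := fun a =>
      (integrable_dirac (by simp))
    rw [hμ, integral_add_measure ((hi 0).smul_measure (by simp)) ((hi 1).smul_measure (by simp)),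
      integral_smul_measure, integral_smul_measure, integral_dirac, integral_dirac,
      ENNReal.toReal_ofReal (by linarith), ENNReal.toReal_ofReal hp0]
    simp
  have hmem : ∀ᵐ x ∂μ, x ∈ Set.Icc (0 : ℝ) 1 := by
    rw [hμ, ae_add_measure_iff]
    constructor
    · exact Measure.ae_smul_measure ((ae_dirac_iff measurableSet_Icc).2 (by simp)) _
    · exact Measure.ae_smul_measure ((ae_dirac_iff measurableSet_Icc).2 (by simp)) _
  have h := (hasSubgaussianMGF_of_mem_Icc (X := fun x : ℝ => x) (μ := μ) (by fun_prop) hmem).mgf_le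
    (-l)
  have hmean : ∫ x, x ∂μ = p := by rw [hint (fun x => x) measurable_id]; ring
  rw [hmean, mgf, hint _ (by fun_prop)] at h
  have h2 : (1 - p) * Real.exp (-l * (0 - p)) + p * Real.exp (-l * (1 - p)) =
      (1 - p + p * Real.exp (-l)) * Real.exp (l * p) := by
    rw [add_mul, mul_assoc p, ← Real.exp_add]; ring_nf
  have h3 : (((‖(1 : ℝ) - 0‖₊ / 2) ^ 2 : ℝ≥0) : ℝ) * (-l) ^ 2 / 2 = l ^ 2 / 8 := by
    simp; ring
  rw [h2, h3] at h
  rw [Real.exp_add, Real.exp_neg (l * p), ← div_eq_inv_mul, le_div_iff₀ (Real.exp_pos _)]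
  exact h

open Classical in
/-- Lower tail of the number of occurrences of adapted events each of which has conditional
probability at least `p` given the past. -/
lemma measureReal_sum_indicator_lt_le {Ω : Type*} {mΩ : MeasurableSpace Ω} {P : Measure Ω}
    [IsProbabilityMeasure P] {m : ℕ → MeasurableSpace Ω} (hm : ∀ k, m k ≤ mΩ) (hmono : Monotone m)
    {J : ℕ → Set Ω} (hJ : ∀ k, MeasurableSet[m (k + 1)] (J k)) {p q : ℝ} (hp0 : 1 / 2 ≤ p)
    (hp1 : p ≤ 1) (hqp : q ≤ p)
    (h : ∀ k A, MeasurableSet[m k] A → p * P.real A ≤ P.real (A ∩ J k)) (t : ℕ) :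
    P.real {ω | ∑ k ∈ Finset.range t, (if ω ∈ J k then (1 : ℝ) else 0) < q * t} ≤
      Real.exp (-((p - q) ^ 2 / (2 * p ^ 2) * t)) := by
  have hp : 0 < p := by linarith
  -- the minimizer of the exponent `-l (p - q) + l² p² / 2`
  set l : ℝ := (p - q) / p ^ 2 with hl
  have hl0 : 0 ≤ l := div_nonneg (by linarith) (by positivity)
  set W : ℕ → Ω → ℝ := fun t ω =>
    Real.exp (-(l * ∑ k ∈ Finset.range t, (if ω ∈ J k then (1 : ℝ) else 0))) with hW
  have hWm : ∀ t, Measurable[m t] (W t) := by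
    intro t
    refine Real.measurable_exp.comp ((Measurable.const_mul ?_ l).neg)
    refine Finset.measurable_fun_sum _ fun k hk => ?_
    have : MeasurableSet[m t] (J k) := hmono (Nat.succ_le_of_lt (Finset.mem_range.1 hk)) _ (hJ k)
    exact Measurable.ite this measurable_const measurable_const
  have hW0 : ∀ t ω, 0 ≤ W t ω := fun t ω => (Real.exp_pos _).le
  have hW1 : ∀ t ω, W t ω ≤ 1 := by
    intro t ω
    refine Real.exp_le_one_iff.2 (neg_nonpos.2 (mul_nonneg hl0 (Finset.sum_nonneg fun k _ => ?_)))
    split_ifs <;> norm_num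
  have hWi : ∀ t, Integrable (W t) P := fun t =>
    Integrable.of_bound ((hWm t).mono (hm t) le_rfl).aestronglyMeasurable 1
      (Filter.Eventually.of_forall fun ω => by
        rw [Real.norm_of_nonneg (hW0 t ω)]; exact hW1 t ω)
  have hstep : ∀ t, ∫ ω, W (t + 1) ω ∂P ≤
      (1 - p + p * Real.exp (-l)) * ∫ ω, W t ω ∂P := by
    intro t
    have hJm : MeasurableSet (J t) := hm _ _ (hJ t)
    have h1 : ∀ ω, W (t + 1) ω = W t ω - (1 - Real.exp (-l)) * (J t).indicator (W t) ω := by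
      intro ω
      simp only [hW, Finset.sum_range_succ]
      by_cases hω : ω ∈ J t
      · rw [if_pos hω, Set.indicator_of_mem hω, mul_add, neg_add, Real.exp_add, mul_one]; ring
      · rw [if_neg hω, Set.indicator_of_notMem hω]; simp
    simp only [h1]
    rw [integral_sub (hWi t) (((hWi t).indicator hJm).const_mul _), integral_const_mul,
      integral_indicator hJm]
    have h2 := mul_integral_le_setIntegral (hm t) hp.le (h t) (hWm t) (hW0 t) (hW1 t)
    have h3 : 0 ≤ 1 - Real.exp (-l) := by
      rw [sub_nonneg]; exact Real.exp_le_one_iff.2 (by linarith)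
    have h4 := mul_le_mul_of_nonneg_left h2 h3
    linarith
  have hfac : 1 - p + p * Real.exp (-l) ≤ Real.exp (-(l * p) + l ^ 2 * p ^ 2 / 2) := by
    refine (one_sub_add_mul_exp_neg_le hp.le hp1 l).trans (Real.exp_le_exp.2 ?_)
    have : (1 / 2) ^ 2 ≤ p ^ 2 := pow_le_pow_left₀ (by norm_num) hp0 2
    nlinarith [sq_nonneg l]
  have hbound : ∀ t : ℕ, ∫ ω, W t ω ∂P ≤ Real.exp (t * (-(l * p) + l ^ 2 * p ^ 2 / 2)) := by
    intro t
    induction t with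
    | zero => simp [hW]
    | succ t ih =>
      refine (hstep t).trans ?_
      rw [Nat.cast_succ, add_mul (t : ℝ), one_mul, Real.exp_add, mul_comm]
      exact mul_le_mul ih hfac
        (add_nonneg (by linarith) (mul_nonneg hp.le (Real.exp_pos _).le)) (Real.exp_pos _).le
  have hsub : {ω | ∑ k ∈ Finset.range t, (if ω ∈ J k then (1 : ℝ) else 0) < q * t} ⊆
      {ω | Real.exp (-(l * (q * t))) ≤ W t ω} := by
    intro ω hω
    have hω' : ∑ k ∈ Finset.range t, (if ω ∈ J k then (1 : ℝ) else 0) < q * t := hω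
    exact Real.exp_le_exp.2 (neg_le_neg (mul_le_mul_of_nonneg_left hω'.le hl0))
  refine (measureReal_mono hsub).trans ?_
  have hmarkov := mul_meas_ge_le_integral_of_nonneg (μ := P) (f := W t)
    (Filter.Eventually.of_forall (hW0 t)) (hWi t) (Real.exp (-(l * (q * t))))
  have h5 := hmarkov.trans (hbound t)
  rw [← le_div_iff₀' (Real.exp_pos _), ← Real.exp_sub] at h5
  refine h5.trans (Real.exp_le_exp.2 (le_of_eq ?_))
  rw [hl]; field_simp; ring

/-- Optimizing the Chernoff exponent over `[0, 1/b]`, in terms of `subexpTail`. -/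
lemma le_subexpTail_mul {u ν b y a : ℝ} (hu : 0 ≤ u) (hν : 0 ≤ ν) (hb : 0 ≤ b) (ha : 0 ≤ a)
    (h : ∀ l : ℝ, 0 ≤ l → l * b ≤ 1 → y ≤ Real.exp (l ^ 2 * ν ^ 2 / 2 - l * u) * a) :
    y ≤ subexpTail u ν b * a := by
  have hfin : ∀ v : ℝ, 0 ≤ v →
      (EReal.exp (-((ENNReal.ofReal v : ℝ≥0∞) : EReal))).toReal = Real.exp (-v) := by
    intro v hv
    rw [EReal.coe_ennreal_ofReal, max_eq_left hv, ← EReal.coe_neg, EReal.exp_coe,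
      ENNReal.toReal_ofReal (Real.exp_pos _).le]
  -- it suffices to reach `exp (-v)` for some finite `v` that is at least the minimum
  have hle : ∀ v : ℝ, 0 ≤ v → min (ENNReal.ofReal (u ^ 2) / ENNReal.ofReal (2 * ν ^ 2))
      (ENNReal.ofReal u / ENNReal.ofReal (2 * b)) ≤ ENNReal.ofReal v →
      y ≤ Real.exp (-v) * a → y ≤ subexpTail u ν b * a := by
    intro v hv hmin hy
    refine hy.trans (mul_le_mul_of_nonneg_right ?_ ha)
    rw [← hfin v hv, subexpTail]
    refine ENNReal.toReal_mono ?_ ?_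
    · refine ne_top_of_le_ne_top ENNReal.one_ne_top ?_
      rw [← EReal.exp_zero]
      refine EReal.exp_monotone ?_
      rw [EReal.neg_le, neg_zero]
      exact EReal.coe_ennreal_nonneg _
    · exact EReal.exp_monotone (EReal.neg_le_neg_iff.2 (EReal.coe_ennreal_le_coe_ennreal_iff.2 hmin))
  rcases hu.eq_or_lt with rfl | hu
  · exact hle 0 le_rfl (by simp) (by simpa using h 0 le_rfl (by simp))
  rcases hν.eq_or_lt with rfl | hν
  · rcases hb.eq_or_lt with rfl | hb
    · -- without any noise every multiplier is allowed, and the tail vanishes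
      have hy : y ≤ 0 := by
        have hlim : Filter.Tendsto (fun l : ℝ => Real.exp (-(l * u)) * a) Filter.atTop
            (nhds (0 * a)) :=
          ((Real.tendsto_exp_neg_atTop_nhds_zero).comp
            (Filter.tendsto_id.atTop_mul_const hu)).mul_const a
        rw [zero_mul] at hlim
        refine ge_of_tendsto hlim ?_
        filter_upwards [Filter.eventually_ge_atTop 0] with l hl
        simpa using h l hl (by simp)
      exact hy.trans (mul_nonneg ENNReal.toReal_nonneg ha)
    · refine hle (u / (2 * b)) (by positivity) ?_ ?_
      · rw [ENNReal.ofReal_div_of_pos (by positivity)]; exact min_le_right _ _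
      · refine (h b⁻¹ (by positivity) (inv_mul_cancel₀ hb.ne').le).trans ?_
        gcongr
        have : b⁻¹ * u = 2 * (u / (2 * b)) := by field_simp
        have h2 : 0 ≤ u / (2 * b) := by positivity
        rw [this]; linarith
  · by_cases hc : u / ν ^ 2 * b ≤ 1
    · refine hle (u ^ 2 / (2 * ν ^ 2)) (by positivity) ?_ ?_
      · rw [ENNReal.ofReal_div_of_pos (by positivity)]; exact min_le_left _ _
      · refine (h (u / ν ^ 2) (by positivity) hc).trans (le_of_eq ?_)
        congr 2
        field_simp; ring
    · have hb : 0 < b := by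
        rcases hb.eq_or_lt with rfl | hb
        · simp at hc
        · exact hb
      refine hle (u / (2 * b)) (by positivity) ?_ ?_
      · rw [ENNReal.ofReal_div_of_pos (by positivity)]; exact min_le_right _ _
      · refine (h b⁻¹ (by positivity) (inv_mul_cancel₀ hb.ne').le).trans ?_
        gcongr
        have h1 : ν ^ 2 ≤ u * b := by
          rw [not_le, div_mul_eq_mul_div, one_lt_div (by positivity)] at hc
          exact hc.le
        have h2 : b⁻¹ ^ 2 * ν ^ 2 / 2 ≤ b⁻¹ ^ 2 * (u * b) / 2 := by gcongr
        have h3 : b⁻¹ ^ 2 * (u * b) / 2 - b⁻¹ * u = -(u / (2 * b)) := by field_simp; ring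
        linarith

/-- Markov's inequality for the product of independent variables with mean at most `C`, in
logarithmic form. -/
lemma measureReal_lt_sum_log_le {Ω : Type*} {mΩ : MeasurableSpace Ω} {P : Measure Ω}
    [IsProbabilityMeasure P] {Y : ℕ → Ω → ℝ} (hind : iIndepFun Y P) (hYm : ∀ k, Measurable (Y k))
    (hY : ∀ k ω, 0 < Y k ω) {C : ℝ} (hC : 0 < C)
    (hmean : ∀ k, ∫⁻ ω, ENNReal.ofReal (Y k ω) ∂P ≤ ENNReal.ofReal C) (s : ℝ) (t : ℕ) :
    P.real {ω | t * (Real.log C + s) < ∑ k ∈ Finset.range t, Real.log (Y k ω)} ≤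
      Real.exp (-(s * t)) := by
  have hprod : ∫⁻ ω, ∏ k ∈ Finset.range t, ENNReal.ofReal (Y k ω) ∂P ≤ ENNReal.ofReal (C ^ t) := by
    rw [lintegral_prod_eq_prod_lintegral_of_indepFun (Finset.range t)
      (fun k ω => ENNReal.ofReal (Y k ω))
      (hind.comp (fun _ => ENNReal.ofReal) fun _ => ENNReal.measurable_ofReal)
      fun k => (hYm k).ennreal_ofReal, ENNReal.ofReal_pow hC.le]
    exact (Finset.prod_le_prod' fun k _ => hmean k).trans (by simp)
  have hsub : {ω | t * (Real.log C + s) < ∑ k ∈ Finset.range t, Real.log (Y k ω)} ⊆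
      {ω | ENNReal.ofReal (C ^ t * Real.exp (s * t)) ≤
        ∏ k ∈ Finset.range t, ENNReal.ofReal (Y k ω)} := by
    intro ω hω
    have hω' : t * (Real.log C + s) < ∑ k ∈ Finset.range t, Real.log (Y k ω) := hω
    change ENNReal.ofReal _ ≤ _
    rw [← ENNReal.ofReal_prod_of_nonneg fun k _ => (hY k ω).le]
    refine ENNReal.ofReal_le_ofReal ?_
    rw [← Real.log_le_log_iff (by positivity) (Finset.prod_pos fun k _ => hY k ω),
      Real.log_mul (by positivity) (Real.exp_pos _).ne', Real.log_pow, Real.log_exp,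
      Real.log_prod fun k _ => (hY k ω).ne']
    linarith
  have hpos : 0 < C ^ t * Real.exp (s * t) := by positivity
  have hmeas : Measurable fun ω => ∏ k ∈ Finset.range t, ENNReal.ofReal (Y k ω) :=
    Finset.measurable_fun_prod _ fun k _ => (hYm k).ennreal_ofReal
  have h1 := (mul_meas_ge_le_lintegral (μ := P) hmeas
    (ENNReal.ofReal (C ^ t * Real.exp (s * t)))).trans hprod
  refine (measureReal_mono hsub).trans ?_
  rw [← ofReal_measureReal, ← ENNReal.ofReal_mul hpos.le,
    ENNReal.ofReal_le_ofReal_iff (by positivity), mul_assoc] at h1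
  have h2 := le_of_mul_le_mul_left (h1.trans_eq (mul_one _).symm) (by positivity : 0 < C ^ t)
  rw [Real.exp_neg, ← one_div, le_div_iff₀' (Real.exp_pos _)]
  exact h2

/-! ### Accurate iterations and noise of the random process -/

section RandomProcess

variable {n : ℕ} {S₀ S₁ Ω : Type*} [MeasurableSpace S₀] [MeasurableSpace S₁]
  {I : QSASSInput n} {O₀ : ZerothOracle n S₀} {O₁ : FirstOracle n S₁}
  {ξg : ℕ → Ω → S₁} {ξ ξp : ℕ → Ω → S₀} {φ : Vec n → ℝ} {εg τ κ δ ν b : ℝ}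

/-- The event that iteration `k` is true: its gradient estimate is accurate and the sum of its two
function value errors is at most `2 εf`. -/
def qsassTrueEvent (I : QSASSInput n) (O₀ : ZerothOracle n S₀) (O₁ : FirstOracle n S₁)
    (φ : Vec n → ℝ) (εg τ κ : ℝ) (ξg : ℕ → Ω → S₁) (ξ ξp : ℕ → Ω → S₀) (k : ℕ) : Set Ω :=
  {ω | IsAccurateGradient φ εg τ κ (qsassState I O₀ O₁ ξg ξ ξp k ω).x
      (qsassState I O₀ O₁ ξg ξ ξp k ω).α
      (O₁.g (qsassState I O₀ O₁ ξg ξ ξp k ω).x (qsassState I O₀ O₁ ξg ξ ξp k ω).α (ξg k ω))} ∩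
    {ω | qsassErr I O₀ O₁ φ ξg ξ ξp k ω + qsassErrTrial I O₀ O₁ φ ξg ξ ξp k ω ≤ 2 * I.εf}

lemma measurable_qsassState_x (k : ℕ) :
    Measurable[qsassPast ξg ξ ξp k] fun ω => (qsassState I O₀ O₁ ξg ξ ξp k ω).x := by
  obtain ⟨hx, -, -, -, -⟩ := measurableState_qsassState (ξg := ξg) (ξ := ξ) (ξp := ξp) I O₀ O₁ k
  exact hx

lemma measurable_qsassTrial (k : ℕ) :
    Measurable[qsassPast ξg ξ ξp k ⊔ MeasurableSpace.comap (ξg k) inferInstance]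
      (qsassTrial I O₀ O₁ ξg ξ ξp k) := by
  have hst := (measurableState_qsassState (ξg := ξg) (ξ := ξ) (ξp := ξp) I O₀ O₁ k).mono
    (le_sup_left (b := MeasurableSpace.comap (ξg k) inferInstance))
  have hg : Measurable[qsassPast ξg ξ ξp k ⊔ MeasurableSpace.comap (ξg k) inferInstance] (ξg k) :=
    (comap_measurable _).mono le_sup_right le_rfl
  let _ := qsassPast ξg ξ ξp k ⊔ MeasurableSpace.comap (ξg k) inferInstance
  exact hst.trial I (O₁.measurable_comp hst.x hst.α hg)

lemma measurable_qsassErr (hφ : Measurable φ) (k : ℕ) :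
    Measurable[qsassPast ξg ξ ξp (k + 1)] (qsassErr I O₀ O₁ φ ξg ξ ξp k) := by
  have hst := (measurableState_qsassState (ξg := ξg) (ξ := ξ) (ξp := ξp) I O₀ O₁ k).mono
    (qsassPast_mono k.le_succ)
  have h2 := measurable_ξ_past (ξg := ξg) (ξ := ξ) (ξp := ξp) k.lt_succ_self
  let _ := qsassPast ξg ξ ξp (k + 1)
  exact (O₀.measurable_err hφ).comp (hst.x.prodMk h2)

lemma measurable_qsassErrTrial (hφ : Measurable φ) (k : ℕ) :
    Measurable[qsassPast ξg ξ ξp (k + 1)] (qsassErrTrial I O₀ O₁ φ ξg ξ ξp k) := by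
  have hle : qsassPast ξg ξ ξp k ⊔ MeasurableSpace.comap (ξg k) inferInstance ≤
      qsassPast ξg ξ ξp (k + 1) :=
    sup_le (qsassPast_mono k.le_succ)
      (measurable_iff_comap_le.1 (measurable_ξg_past k.lt_succ_self))
  have hx := (measurable_qsassTrial (I := I) (O₀ := O₀) (O₁ := O₁) (ξg := ξg) (ξ := ξ) (ξp := ξp)
    k).mono hle le_rfl
  have h3 := measurable_ξp_past (ξg := ξg) (ξ := ξ) (ξp := ξp) k.lt_succ_self
  let _ := qsassPast ξg ξ ξp (k + 1)
  exact (O₀.measurable_err hφ).comp (hx.prodMk h3)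

lemma FirstOracle.measurableSet_accurate (O₁ : FirstOracle n S₁)
    (hgrad : Measurable (gradient φ)) (εg τ κ : ℝ) :
    MeasurableSet {q : (Vec n × ℝ) × S₁ |
      IsAccurateGradient φ εg τ κ q.1.1 q.1.2 (O₁.g q.1.1 q.1.2 q.2)} := by
  have hg := O₁.measurable_g
  refine measurableSet_le ((hg.sub (hgrad.comp measurable_fst.fst)).norm) ?_
  exact measurable_const.max
    ((measurable_const.min (measurable_fst.snd.const_mul κ)).mul hg.norm)

lemma measurableSet_qsassTrueEvent (hφ : Measurable φ) (hgrad : Measurable (gradient φ)) (k : ℕ) :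
    MeasurableSet[qsassPast ξg ξ ξp (k + 1)]
      (qsassTrueEvent I O₀ O₁ φ εg τ κ ξg ξ ξp k) := by
  have hst := (measurableState_qsassState (ξg := ξg) (ξ := ξ) (ξp := ξp) I O₀ O₁ k).mono
    (qsassPast_mono k.le_succ)
  have h1 := measurable_ξg_past (ξg := ξg) (ξ := ξ) (ξp := ξp) k.lt_succ_self
  have hE := measurable_qsassErr (I := I) (O₀ := O₀) (O₁ := O₁) (ξg := ξg) (ξ := ξ) (ξp := ξp) hφ k
  have hEp := measurable_qsassErrTrial (I := I) (O₀ := O₀) (O₁ := O₁) (ξg := ξg) (ξ := ξ)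
    (ξp := ξp) hφ k
  let _ := qsassPast ξg ξ ξp (k + 1)
  exact (((hst.x.prodMk hst.α).prodMk h1) (O₁.measurableSet_accurate hgrad εg τ κ)).inter
    (measurableSet_le (hE.add hEp) measurable_const)

variable [MeasurableSpace Ω] {P : Measure Ω}

namespace IsQSASSRun

lemma past_le (hrun : IsQSASSRun P I O₀ O₁ ξg ξ ξp) (k : ℕ) :
    qsassPast ξg ξ ξp k ≤ ‹MeasurableSpace Ω› :=
  iSup_le fun j => sup_le (sup_le (hrun.measurable_ξg j).comap_le (hrun.measurable_ξ j).comap_le)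
    (hrun.measurable_ξp j).comap_le

lemma past_sup_le (hrun : IsQSASSRun P I O₀ O₁ ξg ξ ξp) (k : ℕ) :
    qsassPast ξg ξ ξp k ⊔ MeasurableSpace.comap (ξg k) inferInstance ≤ ‹MeasurableSpace Ω› :=
  sup_le (hrun.past_le k) (hrun.measurable_ξg k).comap_le

variable [IsProbabilityMeasure P]

lemma setLIntegral_err_le (hrun : IsQSASSRun P I O₀ O₁ ξg ξ ξp) (k : ℕ)
    {F : Vec n × S₀ → ℝ≥0∞} (hF : Measurable F) {C : ℝ≥0∞}
    (hC : ∀ x, ∫⁻ s, F (x, s) ∂(O₀.law x) ≤ C) {A : Set Ω}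
    (hA : MeasurableSet[qsassPast ξg ξ ξp k] A) :
    ∫⁻ ω in A, F ((qsassState I O₀ O₁ ξg ξ ξp k ω).x, ξ k ω) ∂P ≤ C * P A :=
  have := O₀.markov
  setLIntegral_comp_le_of_condLaw (hrun.past_le k) (measurable_qsassState_x k)
    (hrun.measurable_ξ k) (hrun.law_ξ k) hF hA hC

lemma setLIntegral_errTrial_le (hrun : IsQSASSRun P I O₀ O₁ ξg ξ ξp) (k : ℕ)
    {F : Vec n × S₀ → ℝ≥0∞} (hF : Measurable F) {C : ℝ≥0∞}
    (hC : ∀ x, ∫⁻ s, F (x, s) ∂(O₀.law x) ≤ C) {A : Set Ω}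
    (hA : MeasurableSet[qsassPast ξg ξ ξp k] A) :
    ∫⁻ ω in A, F (qsassTrial I O₀ O₁ ξg ξ ξp k ω, ξp k ω) ∂P ≤ C * P A :=
  have := O₀.markov
  setLIntegral_comp_le_of_condLaw (hrun.past_sup_le k) (measurable_qsassTrial k)
    (hrun.measurable_ξp k) (hrun.law_ξp k) hF (le_sup_left (α := MeasurableSpace Ω) _ hA) hC

/-- Given the past, the gradient estimate is accurate with probability at least `1 - δ`. -/
lemma mul_le_measureReal_accurate (hrun : IsQSASSRun P I O₀ O₁ ξg ξ ξp) (hI : I.Admissible)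
    (hO₁ : O₁.IsAccurate φ εg τ κ δ) (hgrad : Measurable (gradient φ)) (k : ℕ) {A : Set Ω}
    (hA : MeasurableSet[qsassPast ξg ξ ξp k] A) :
    (1 - δ) * P.real A ≤ P.real (A ∩ {ω | IsAccurateGradient φ εg τ κ
      (qsassState I O₀ O₁ ξg ξ ξp k ω).x (qsassState I O₀ O₁ ξg ξ ξp k ω).α
      (O₁.g (qsassState I O₀ O₁ ξg ξ ξp k ω).x (qsassState I O₀ O₁ ξg ξ ξp k ω).α (ξg k ω))}) := by
  have := O₁.markov
  have hst := measurableState_qsassState (ξg := ξg) (ξ := ξ) (ξp := ξp) I O₀ O₁ k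
  set D : Set ((Vec n × ℝ) × S₁) := {q |
    IsAccurateGradient φ εg τ κ q.1.1 q.1.2 (O₁.g q.1.1 q.1.2 q.2)} with hD
  have hDm : MeasurableSet D := O₁.measurableSet_accurate hgrad εg τ κ
  set X : Ω → Vec n × ℝ := fun ω =>
    ((qsassState I O₀ O₁ ξg ξ ξp k ω).x, (qsassState I O₀ O₁ ξg ξ ξp k ω).α) with hX
  have hXm : Measurable[qsassPast ξg ξ ξp k] X := by
    obtain ⟨h1, h2, -, -, -⟩ := hst
    exact h1.prodMk h2
  have hXm' : Measurable X := hXm.mono (hrun.past_le k) le_rfl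
  have heq := setLIntegral_comp_eq_of_condLaw (hrun.past_le k) hXm (hrun.measurable_ξg k)
    (hrun.law_ξg k) (F := D.indicator 1) (measurable_one.indicator hDm) hA
  have hleft : ∫⁻ ω in A, D.indicator 1 (X ω, ξg k ω) ∂P =
      P (A ∩ {ω | (X ω, ξg k ω) ∈ D}) := by
    have hpre : MeasurableSet {ω | (X ω, ξg k ω) ∈ D} :=
      (hXm'.prodMk (hrun.measurable_ξg k)) hDm
    have : ∀ ω, D.indicator (1 : (Vec n × ℝ) × S₁ → ℝ≥0∞) (X ω, ξg k ω) =
        {ω | (X ω, ξg k ω) ∈ D}.indicator 1 ω := fun ω => rfl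
    simp only [this]
    rw [lintegral_indicator_one hpre, Measure.restrict_apply hpre, Set.inter_comm]
  have hright : ENNReal.ofReal (1 - δ) * P A ≤
      ∫⁻ ω in A, ∫⁻ s, D.indicator 1 (X ω, s) ∂(O₁.law (X ω)) ∂P := by
    rw [← setLIntegral_const]
    refine lintegral_mono fun ω => ?_
    have hsec : MeasurableSet {s | (X ω, s) ∈ D} := measurable_prodMk_left hDm
    have h1 : ∫⁻ s, D.indicator 1 (X ω, s) ∂(O₁.law (X ω)) = O₁.law (X ω) {s | (X ω, s) ∈ D} :=
      lintegral_indicator_one hsec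
    rw [h1, ← ofReal_measureReal]
    exact ENNReal.ofReal_le_ofReal (hO₁.prob_ge _ _ (qsassState_α_pos hI k ω))
  rw [← heq, hleft, ← ofReal_measureReal, ← ofReal_measureReal,
    ← ENNReal.ofReal_mul (by linarith [hO₁.δ_mem.2])] at hright
  exact (ENNReal.ofReal_le_ofReal_iff measureReal_nonneg).1 hright

end IsQSASSRun

lemma ZerothOracle.IsAccurate.iInf_nonneg (hO₀ : O₀.IsAccurate φ I.εf ν b) :
    0 ≤ ⨅ x, (I.εf - O₀.meanErr φ x) :=
  le_ciInf fun x => sub_nonneg.2 (hO₀.mean_le x)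

lemma ZerothOracle.IsAccurate.lintegral_err_le (hO₀ : O₀.IsAccurate φ I.εf ν b) (x : Vec n) :
    ∫⁻ s, ENNReal.ofReal (O₀.err φ x s) ∂(O₀.law x) ≤ ENNReal.ofReal I.εf := by
  rw [← ofReal_integral_eq_lintegral_ofReal (hO₀.integrable x)
    (Filter.Eventually.of_forall fun s => abs_nonneg _)]
  exact ENNReal.ofReal_le_ofReal (hO₀.mean_le x)

lemma ZerothOracle.IsAccurate.lintegral_exp_err_le (hO₀ : O₀.IsAccurate φ I.εf ν b) {l : ℝ}
    (hl : 0 ≤ l) (hlb : l * b ≤ 1) (x : Vec n) :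
    ∫⁻ s, ENNReal.ofReal (Real.exp (l * O₀.err φ x s)) ∂(O₀.law x) ≤
      ENNReal.ofReal (Real.exp (l * (I.εf - ⨅ x, (I.εf - O₀.meanErr φ x)) + l ^ 2 * ν ^ 2 / 2)) := by
  have hsplit : ∀ s, Real.exp (l * O₀.err φ x s) =
      Real.exp (l * O₀.meanErr φ x) * Real.exp (l * (O₀.err φ x s - O₀.meanErr φ x)) := by
    intro s; rw [← Real.exp_add]; ring_nf
  simp only [hsplit]
  rw [← ofReal_integral_eq_lintegral_ofReal ((hO₀.exp_integrable x l hl hlb).const_mul _)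
    (Filter.Eventually.of_forall fun s => by positivity), integral_const_mul, Real.exp_add]
  refine ENNReal.ofReal_le_ofReal (mul_le_mul ?_ (hO₀.mgf_le x l hl hlb)
    (integral_nonneg fun s => (Real.exp_pos _).le) (Real.exp_pos _).le)
  refine Real.exp_le_exp.2 (mul_le_mul_of_nonneg_left ?_ hl)
  have hbdd : BddBelow (Set.range fun x => I.εf - O₀.meanErr φ x) :=
    ⟨0, by rintro _ ⟨y, rfl⟩; exact sub_nonneg.2 (hO₀.mean_le y)⟩
  linarith [ciInf_le hbdd x]

variable [IsProbabilityMeasure P]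

namespace IsQSASSRun

/-- Given the past, the sum of the two errors exceeds `2 εf` with probability at most
`subexpTail u ν b`. Convexity of `exp` replaces the unknown joint law of the two errors by their
marginal laws. -/
lemma measureReal_lt_err_add_le (hrun : IsQSASSRun P I O₀ O₁ ξg ξ ξp)
    (hO₀ : O₀.IsAccurate φ I.εf ν b) (hφ : Measurable φ) (k : ℕ) {A : Set Ω}
    (hA : MeasurableSet[qsassPast ξg ξ ξp k] A) :
    P.real (A ∩ {ω | 2 * I.εf < qsassErr I O₀ O₁ φ ξg ξ ξp k ω +
      qsassErrTrial I O₀ O₁ φ ξg ξ ξp k ω}) ≤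
      subexpTail (⨅ x, (I.εf - O₀.meanErr φ x)) ν b * P.real A := by
  refine le_subexpTail_mul hO₀.iInf_nonneg hO₀.ν_nonneg hO₀.b_nonneg measureReal_nonneg
    fun l hl hlb => ?_
  set u := ⨅ x, (I.εf - O₀.meanErr φ x)
  have hEm := (measurable_qsassErr (I := I) (O₀ := O₀) (O₁ := O₁) (ξg := ξg) (ξ := ξ) (ξp := ξp)
    hφ k).mono (hrun.past_le (k + 1)) le_rfl
  have hEpm := (measurable_qsassErrTrial (I := I) (O₀ := O₀) (O₁ := O₁) (ξg := ξg) (ξ := ξ)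
    (ξp := ξp) hφ k).mono (hrun.past_le (k + 1)) le_rfl
  have hFm : Measurable fun q : Vec n × S₀ =>
      ENNReal.ofReal (Real.exp (l * O₀.err φ q.1 q.2)) :=
    (Real.measurable_exp.comp ((O₀.measurable_err hφ).const_mul l)).ennreal_ofReal
  have h1 := hrun.setLIntegral_err_le k hFm (hO₀.lintegral_exp_err_le hl hlb) hA
  have h2 := hrun.setLIntegral_errTrial_le k hFm (hO₀.lintegral_exp_err_le hl hlb) hA
  set E := qsassErr I O₀ O₁ φ ξg ξ ξp k with hE
  set Ep := qsassErrTrial I O₀ O₁ φ ξg ξ ξp k with hEp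
  change ∫⁻ ω in A, ENNReal.ofReal (Real.exp (l * E ω)) ∂P ≤ _ at h1
  change ∫⁻ ω in A, ENNReal.ofReal (Real.exp (l * Ep ω)) ∂P ≤ _ at h2
  have hbad : MeasurableSet {ω | 2 * I.εf < E ω + Ep ω} :=
    measurableSet_lt measurable_const (hEm.add hEpm)
  have h3 : P (A ∩ {ω | 2 * I.εf < E ω + Ep ω}) ≤ ENNReal.ofReal (Real.exp (-(l * I.εf)) / 2) *
      (∫⁻ ω in A, ENNReal.ofReal (Real.exp (l * E ω)) ∂P +
        ∫⁻ ω in A, ENNReal.ofReal (Real.exp (l * Ep ω)) ∂P) := by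
    rw [← lintegral_add_left (by fun_prop), ← lintegral_const_mul _ (by fun_prop),
      Set.inter_comm, ← Measure.restrict_apply hbad, ← lintegral_indicator_one hbad]
    refine lintegral_mono fun ω => ?_
    rw [← ENNReal.ofReal_add (Real.exp_pos _).le (Real.exp_pos _).le,
      ← ENNReal.ofReal_mul (by positivity)]
    by_cases hω : ω ∈ {ω | 2 * I.εf < E ω + Ep ω}
    · rw [Set.indicator_of_mem hω, Pi.one_apply, ← ENNReal.ofReal_one]
      refine ENNReal.ofReal_le_ofReal ?_
      have hω' : 2 * I.εf < E ω + Ep ω := hω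
      have h4 : Real.exp (l * ((E ω + Ep ω) / 2)) ≤
          (Real.exp (l * E ω) + Real.exp (l * Ep ω)) / 2 := by
        have := convexOn_exp.2 (Set.mem_univ (l * E ω)) (Set.mem_univ (l * Ep ω))
          (by norm_num : (0 : ℝ) ≤ 1 / 2) (by norm_num : (0 : ℝ) ≤ 1 / 2) (by norm_num)
        simp only [smul_eq_mul] at this
        have h5 : l * ((E ω + Ep ω) / 2) = 1 / 2 * (l * E ω) + 1 / 2 * (l * Ep ω) := by ring
        rw [h5]; linarith
      have h6 : 1 ≤ Real.exp (-(l * I.εf)) * Real.exp (l * ((E ω + Ep ω) / 2)) := by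
        rw [← Real.exp_add]
        refine Real.one_le_exp ?_
        have := mul_le_mul_of_nonneg_left (by linarith : I.εf ≤ (E ω + Ep ω) / 2) hl
        linarith
      have h7 := mul_le_mul_of_nonneg_left h4 (Real.exp_pos (-(l * I.εf))).le
      linarith
    · rw [Set.indicator_of_notMem hω]; exact zero_le
  have h8 := h3.trans (mul_le_mul_right (add_le_add h1 h2) _)
  rw [← ofReal_measureReal, ← ofReal_measureReal, ← ENNReal.ofReal_mul (Real.exp_pos _).le,
    ← ENNReal.ofReal_add (by positivity) (by positivity), ← ENNReal.ofReal_mul (by positivity),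
    ENNReal.ofReal_le_ofReal_iff (by positivity)] at h8
  refine h8.trans (le_of_eq ?_)
  have h9 : Real.exp (l ^ 2 * ν ^ 2 / 2 - l * u) =
      Real.exp (-(l * I.εf)) * Real.exp (l * (I.εf - u) + l ^ 2 * ν ^ 2 / 2) := by
    rw [← Real.exp_add]; ring_nf
  rw [h9]; ring

/-- Each iteration is true with probability at least `p`, given the past. -/
lemma mul_le_measureReal_trueEvent (hrun : IsQSASSRun P I O₀ O₁ ξg ξ ξp) (hI : I.Admissible)
    (hO₀ : O₀.IsAccurate φ I.εf ν b) (hO₁ : O₁.IsAccurate φ εg τ κ δ) (hφ : Measurable φ)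
    (hgrad : Measurable (gradient φ)) {p : ℝ}
    (hp : ((∀ k, ∀ᵐ ω ∂P, qsassErr I O₀ O₁ φ ξg ξ ξp k ω ≤ I.εf ∧
        qsassErrTrial I O₀ O₁ φ ξg ξ ξp k ω ≤ I.εf) ∧ p = 1 - δ) ∨
      p = 1 - δ - subexpTail (⨅ x, (I.εf - O₀.meanErr φ x)) ν b) (k : ℕ) {A : Set Ω}
    (hA : MeasurableSet[qsassPast ξg ξ ξp k] A) :
    p * P.real A ≤ P.real (A ∩ qsassTrueEvent I O₀ O₁ φ εg τ κ ξg ξ ξp k) := by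
  have hG := hrun.mul_le_measureReal_accurate hI hO₁ hgrad k hA
  have hB := hrun.measureReal_lt_err_add_le hO₀ hφ k hA
  unfold qsassTrueEvent
  set G := {ω | IsAccurateGradient φ εg τ κ
      (qsassState I O₀ O₁ ξg ξ ξp k ω).x (qsassState I O₀ O₁ ξg ξ ξp k ω).α
      (O₁.g (qsassState I O₀ O₁ ξg ξ ξp k ω).x (qsassState I O₀ O₁ ξg ξ ξp k ω).α (ξg k ω))}
  set E := qsassErr I O₀ O₁ φ ξg ξ ξp k
  set Ep := qsassErrTrial I O₀ O₁ φ ξg ξ ξp k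
  rcases hp with ⟨hae, rfl⟩ | rfl
  · refine hG.trans (le_of_eq (measureReal_congr ?_))
    refine Filter.eventuallyEq_set.2 ((hae k).mono fun ω hω => ?_)
    have h1 : E ω + Ep ω ≤ 2 * I.εf := by linarith [hω.1, hω.2]
    exact ⟨fun h => ⟨h.1, h.2, h1⟩, fun h => ⟨h.1, h.2.1⟩⟩
  · have hsub : A ∩ G ⊆ (A ∩ (G ∩ {ω | E ω + Ep ω ≤ 2 * I.εf})) ∪
        (A ∩ {ω | 2 * I.εf < E ω + Ep ω}) := by
      intro ω ⟨h1, h2⟩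
      rcases le_or_gt (E ω + Ep ω) (2 * I.εf) with h | h
      · exact Or.inl ⟨h1, h2, h⟩
      · exact Or.inr ⟨h1, h⟩
    have h1 := (measureReal_mono (μ := P) hsub).trans (measureReal_union_le _ _)
    linarith

/-- The accumulated logarithmic noise exceeds its mean rate by `s` per iteration only with
exponentially small probability. -/
lemma measureReal_noise_le (hrun : IsQSASSRun P I O₀ O₁ ξg ξ ξp)
    (hO₀ : O₀.IsAccurate φ I.εf ν b) (hφ : Measurable φ) {ε s : ℝ} (hε : 0 < ε) (hs : 0 ≤ s)
    (hnoise : (∀ k, ∀ᵐ ω ∂P, qsassErr I O₀ O₁ φ ξg ξ ξp k ω ≤ I.εf ∧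
        qsassErrTrial I O₀ O₁ φ ξg ξ ξp k ω ≤ I.εf) ∨
      iIndepFun (fun k ω => qsassErr I O₀ O₁ φ ξg ξ ξp k ω +
        qsassErrTrial I O₀ O₁ φ ξg ξ ξp k ω) P) (t : ℕ) :
    P.real {ω | t * (Real.log (1 + 4 * I.εf / ε) + s) < ∑ k ∈ Finset.range t,
      Real.log (1 + (2 * I.εf + (qsassErr I O₀ O₁ φ ξg ξ ξp k ω +
        qsassErrTrial I O₀ O₁ φ ξg ξ ξp k ω)) / ε)} ≤ Real.exp (-(s * t)) := by
  have hεf := hO₀.εf_nonneg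
  set E := qsassErr I O₀ O₁ φ ξg ξ ξp with hE
  set Ep := qsassErrTrial I O₀ O₁ φ ξg ξ ξp with hEp
  have hE0 : ∀ k ω, 0 ≤ E k ω := fun k ω => abs_nonneg _
  have hEp0 : ∀ k ω, 0 ≤ Ep k ω := fun k ω => abs_nonneg _
  have hpos : ∀ k ω, 0 < 1 + (2 * I.εf + (E k ω + Ep k ω)) / ε := by
    intro k ω
    have := hE0 k ω
    have := hEp0 k ω
    positivity
  rcases hnoise with hbdd | hind
  · have hnull : P.real {ω | t * (Real.log (1 + 4 * I.εf / ε) + s) < ∑ k ∈ Finset.range t,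
        Real.log (1 + (2 * I.εf + (E k ω + Ep k ω)) / ε)} = 0 := by
      rw [measureReal_eq_zero_iff, ← compl_compl {ω | _}]
      change ∀ᵐ ω ∂P, ¬ _
      filter_upwards [ae_all_iff.2 hbdd] with ω hω
      rw [not_lt]
      calc ∑ k ∈ Finset.range t, Real.log (1 + (2 * I.εf + (E k ω + Ep k ω)) / ε)
          ≤ ∑ k ∈ Finset.range t, Real.log (1 + 4 * I.εf / ε) := by
            refine Finset.sum_le_sum fun k _ => Real.log_le_log (hpos k ω) ?_
            have := hω k
            gcongr
            linarith
        _ = t * Real.log (1 + 4 * I.εf / ε) := by simp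
        _ ≤ t * (Real.log (1 + 4 * I.εf / ε) + s) := by gcongr; linarith
    rw [hnull]; positivity
  · have hEm : ∀ k, Measurable (E k) := fun k =>
      (measurable_qsassErr hφ k).mono (hrun.past_le (k + 1)) le_rfl
    have hEpm : ∀ k, Measurable (Ep k) := fun k =>
      (measurable_qsassErrTrial hφ k).mono (hrun.past_le (k + 1)) le_rfl
    refine measureReal_lt_sum_log_le (Y := fun k ω => 1 + (2 * I.εf + (E k ω + Ep k ω)) / ε)
      (hind.comp (fun _ x => 1 + (2 * I.εf + x) / ε) fun _ => by fun_prop)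
      (fun k => by fun_prop) hpos (by positivity) (fun k => ?_) s t
    have hFm : Measurable fun q : Vec n × S₀ => ENNReal.ofReal (O₀.err φ q.1 q.2) :=
      (O₀.measurable_err hφ).ennreal_ofReal
    have h1 := hrun.setLIntegral_err_le k hFm hO₀.lintegral_err_le MeasurableSet.univ
    have h2 := hrun.setLIntegral_errTrial_le k hFm hO₀.lintegral_err_le MeasurableSet.univ
    rw [Measure.restrict_univ, measure_univ, mul_one] at h1 h2
    change ∫⁻ ω, ENNReal.ofReal (E k ω) ∂P ≤ _ at h1
    change ∫⁻ ω, ENNReal.ofReal (Ep k ω) ∂P ≤ _ at h2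
    have h3 : ∀ ω, ENNReal.ofReal (1 + (2 * I.εf + (E k ω + Ep k ω)) / ε) =
        ENNReal.ofReal (1 + 2 * I.εf / ε) +
          ENNReal.ofReal ε⁻¹ * (ENNReal.ofReal (E k ω) + ENNReal.ofReal (Ep k ω)) := by
      intro ω
      have h4 := hE0 k ω
      have h5 := hEp0 k ω
      rw [← ENNReal.ofReal_add h4 h5, ← ENNReal.ofReal_mul (by positivity),
        ← ENNReal.ofReal_add (by positivity) (by positivity)]
      congr 1; field_simp; ring
    simp only [h3]
    rw [lintegral_add_left measurable_const, lintegral_const, measure_univ, mul_one,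
      lintegral_const_mul _ (by fun_prop), lintegral_add_left (by fun_prop)]
    refine (add_le_add le_rfl (mul_le_mul_right (add_le_add h1 h2) _)).trans (le_of_eq ?_)
    rw [← ENNReal.ofReal_add hεf hεf, ← ENNReal.ofReal_mul (by positivity),
      ← ENNReal.ofReal_add (by positivity) (by positivity)]
    congr 1; field_simp; ring

end IsQSASSRun

end RandomProcess

/-! ### Iteration complexity -/

section RandomProcess

variable {n : ℕ} {S₀ S₁ Ω : Type*} [MeasurableSpace S₀] [MeasurableSpace S₁]
  {I : QSASSInput n} {O₀ : ZerothOracle n S₀} {O₁ : FirstOracle n S₁}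
  {ξg : ℕ → Ω → S₁} {ξ ξp : ℕ → Ω → S₀} {φ : Vec n → ℝ} {φstar β : ℝ} {L : ℝ≥0}
  {εg τ κ η αbar ε : ℝ}

open Classical in
/-- The drift of the potential, summed over the iterations before an `ε`-optimal point is found. -/
lemma QSASSInput.Threshold.potential_le (hI : I.Admissible) (hdiff : Differentiable ℝ φ)
    (hLip : LipschitzWith L (gradient φ)) (hconv : IsStronglyConvex φ β)
    (hstar : IsGLB (Set.range φ) φstar) (hτ : 0 ≤ τ) (hκ : 0 ≤ κ) (hεf : 0 ≤ I.εf)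
    (hT : I.Threshold L β τ κ η αbar) (hε : εg ^ 2 / (2 * β * η ^ 2) < ε) (hε4 : 4 * I.εf < ε)
    {i : ℤ} (hi : αbar = I.α₀ * I.γ ^ i) (ω : Ω) (t : ℕ)
    (hgap : ∀ k ≤ t, ε < φ (qsassState I O₀ O₁ ξg ξ ξp k ω).x - φstar) :
    ∃ j : ℤ, (qsassState I O₀ O₁ ξg ξ ξp t ω).α = αbar * I.γ ^ (-j) ∧
      2 * Real.log ((φ (qsassState I O₀ O₁ ξg ξ ξp t ω).x - φstar) / ε) +
          I.h β τ η αbar * |(j : ℝ)| ≤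
        2 * Real.log ((φ I.x₀ - φstar) / ε) + I.h β τ η αbar * |(i : ℝ)| +
          2 * ∑ k ∈ Finset.range t, Real.log (1 + (2 * I.εf +
            (qsassErr I O₀ O₁ φ ξg ξ ξp k ω + qsassErrTrial I O₀ O₁ φ ξg ξ ξp k ω)) / ε) -
          I.h β τ η αbar * (2 * (∑ k ∈ Finset.range t,
            (if ω ∈ qsassTrueEvent I O₀ O₁ φ εg τ κ ξg ξ ξp k then (1 : ℝ) else 0)) - t) := by
  induction t with
  | zero =>
    refine ⟨i, ?_, ?_⟩
    · rw [hi, mul_assoc, ← zpow_add₀ hI.γ_mem.1.ne', add_neg_cancel, zpow_zero, mul_one]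
      rfl
    · simp [qsassState, QSASSInput.init]
  | succ t ih =>
    obtain ⟨j, hj, hle⟩ := ih fun k hk => hgap k (hk.trans t.le_succ)
    obtain ⟨j', hj', hle'⟩ := hT.potential_step hI hdiff hLip hconv hstar hτ hκ hεf hε hε4
      (qsassState_mem_eq_nil t ω) hj (hgap t t.le_succ)
      (g := O₁.g (qsassState I O₀ O₁ ξg ξ ξp t ω).x (qsassState I O₀ O₁ ξg ξ ξp t ω).α (ξg t ω))
      (fk := O₀.f (qsassState I O₀ O₁ ξg ξ ξp t ω).x (ξ t ω))
      (fkp := O₀.f (qsassTrial I O₀ O₁ ξg ξ ξp t ω) (ξp t ω))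
      (E := qsassErr I O₀ O₁ φ ξg ξ ξp t ω) (Ep := qsassErrTrial I O₀ O₁ φ ξg ξ ξp t ω)
      le_rfl le_rfl (hgap (t + 1) le_rfl)
      (J := ω ∈ qsassTrueEvent I O₀ O₁ φ εg τ κ ξg ξ ξp t) fun h => h
    refine ⟨j', hj', hle'.trans ?_⟩
    rw [Finset.sum_range_succ, Finset.sum_range_succ]
    push_cast
    linarith

lemma qsassStop_le_of_gap_le {k t : ℕ} (hk : k ≤ t) {ω : Ω}
    (h : φ (qsassState I O₀ O₁ ξg ξ ξp k ω).x - φstar ≤ ε) :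
    qsassStop I O₀ O₁ φ φstar ε ξg ξ ξp ω ≤ (t : ℕ∞) :=
  iInf₂_le_of_le k h (by exact_mod_cast hk)

end RandomProcess

lemma four_le_subexpParam {εf ν b ε : ℝ} (hεf : 0 ≤ εf) (hν : 0 ≤ ν) (hε : 0 < ε) :
    4 ≤ subexpParam εf ν b ε := by
  have h1 : 0 ≤ max (2 * ν / ε) (2 * b / ε) := le_max_of_le_left (by positivity)
  have h2 : 1 ≤ Real.exp 1 := Real.one_le_exp zero_le_one
  have h3 : 0 ≤ 4 * εf / ε := by positivity
  have h4 : 0 ≤ 4 * Real.exp 1 ^ 2 * max (2 * ν / ε) (2 * b / ε) := by positivity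
  unfold subexpParam
  nlinarith

theorem mainTheorem2 {n : ℕ} {S₀ S₁ Ω : Type*}
    [MeasurableSpace S₀] [MeasurableSpace S₁] [MeasurableSpace Ω]
    (P : Measure Ω) [IsProbabilityMeasure P]
    -- the objective
    (φ : Vec n → ℝ) (φstar : ℝ) (L : ℝ≥0) (β : ℝ)
    (hdiff : Differentiable ℝ φ) (hLip : LipschitzWith L (gradient φ))
    (hstar : IsGLB (Set.range φ) φstar) (hconv : IsStronglyConvex φ β)
    -- the algorithm, its oracles and the random elements that drive it
    (I : QSASSInput n) (hI : I.Admissible)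
    (O₀ : ZerothOracle n S₀) (ν b : ℝ) (hO₀ : O₀.IsAccurate φ I.εf ν b)
    (O₁ : FirstOracle n S₁) (εg τ κ δ : ℝ) (hO₁ : O₁.IsAccurate φ εg τ κ δ)
    (ξg : ℕ → Ω → S₁) (ξ ξp : ℕ → Ω → S₀) (hrun : IsQSASSRun P I O₀ O₁ ξg ξ ξp)
    -- the noise is bounded or independent, and `p` is chosen accordingly
    (p : ℝ)
    (hnoise :
      ((∀ k, ∀ᵐ ω ∂P, qsassErr I O₀ O₁ φ ξg ξ ξp k ω ≤ I.εf ∧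
          qsassErrTrial I O₀ O₁ φ ξg ξ ξp k ω ≤ I.εf) ∧
        p = 1 - δ) ∨
      (iIndepFun (fun k ω => qsassErr I O₀ O₁ φ ξg ξ ξp k ω +
          qsassErrTrial I O₀ O₁ φ ξg ξ ξp k ω) P ∧
        p = 1 - δ - subexpTail (⨅ x, (I.εf - O₀.meanErr φ x)) ν b))
    -- the accuracy level
    (ε η : ℝ) (hε : I.AccuracyLevel L β εg τ κ η p ε)
    -- the step size threshold `αbar`, a value on the step size grid of the algorithm
    (αbar : ℝ) (hgrid : ∃ i : ℤ, αbar = I.α₀ * I.γ ^ i) (hαbar : αbar ≤ I.αmax L κ η)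
    (s : ℝ) (hs : 0 ≤ s) (pl : ℝ)
    (hpl : pl = 1 / 2 + (Real.log (1 + 4 * I.εf / ε) + s) / I.h β τ η αbar)
    (phat : ℝ) (hphat : phat ∈ Set.Ioo pl p)
    (t : ℕ)
    (ht : (t : ℝ) ≥
      (1 / I.h β τ η αbar * Real.log ((φ I.x₀ - φstar) / ε) +
        |-(Real.log I.α₀ - Real.log αbar) / (2 * Real.log I.γ)|) / (phat - pl)) :
    P.real {ω | qsassStop I O₀ O₁ φ φstar ε ξg ξ ξp ω ≤ (t : ℕ∞)} ≥
      1 - Real.exp (-((p - phat) ^ 2 / (2 * p ^ 2) * t))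
        - Real.exp (-(min (s ^ 2 * t / (2 * subexpParam I.εf ν b ε ^ 2))
            (s * t / (2 * subexpParam I.εf ν b ε)))) := by
  classical
  obtain ⟨hη, hp, hε'⟩ := hε
  have hε1 : εg ^ 2 / (2 * β * η ^ 2) < ε := (le_max_left _ _).trans_lt hε'
  have hε4 : 4 * I.εf < ε :=
    ((le_max_right _ _).trans (le_max_right _ _)).trans_lt hε'
  have hεf := hO₀.εf_nonneg
  have hε0 : 0 < ε := lt_of_le_of_lt (by positivity) hε4
  obtain ⟨i, hi⟩ := hgrid
  by_cases h0 : φ I.x₀ - φstar ≤ ε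
  · -- the initial point is already `ε`-optimal
    have huniv : {ω | qsassStop I O₀ O₁ φ φstar ε ξg ξ ξp ω ≤ (t : ℕ∞)} = Set.univ :=
      Set.eq_univ_of_forall fun ω => qsassStop_le_of_gap_le t.zero_le h0
    rw [huniv, probReal_univ]
    have h1 := Real.exp_pos (-((p - phat) ^ 2 / (2 * p ^ 2) * t))
    have h2 := Real.exp_pos (-(min (s ^ 2 * t / (2 * subexpParam I.εf ν b ε ^ 2))
      (s * t / (2 * subexpParam I.εf ν b ε))))
    linarith
  rw [not_le] at h0
  -- a second point exists, hence `β ≤ L`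
  have hβL : β ≤ L := by
    have : ¬ φ I.x₀ ∈ lowerBounds (Set.range φ) := fun hlow => by
      have := hstar.2 hlow
      linarith
    simp only [mem_lowerBounds, Set.forall_mem_range, not_forall, not_le] at this
    obtain ⟨y, hy⟩ := this
    exact hconv.le_lipschitz hLip (x := y) (y := I.x₀) fun h => by
      rw [h] at hy; exact lt_irrefl _ hy
  have hαbar0 : 0 < αbar := by rw [hi]; exact mul_pos hI.α₀_pos (zpow_pos hI.γ_mem.1 i)
  have hT : I.Threshold L β τ κ η αbar :=
    hI.threshold hconv.1 hβL hO₁.τ_nonneg hO₁.κ_nonneg hη hαbar0 hαbar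
  have hh := hT.h_pos
  have hφm : Measurable φ := hdiff.continuous.measurable
  have hgm : Measurable (gradient φ) := hLip.continuous.measurable
  have hp1 : p ≤ 1 := by
    have hδ := hO₁.δ_mem.1
    rcases hnoise with ⟨-, rfl⟩ | ⟨-, rfl⟩
    · linarith
    · have : 0 ≤ subexpTail (⨅ x, (I.εf - O₀.meanErr φ x)) ν b := ENNReal.toReal_nonneg
      linarith
  have hcount := measureReal_sum_indicator_lt_le (P := P) hrun.past_le
    (fun _ _ h => qsassPast_mono h)
    (J := qsassTrueEvent I O₀ O₁ φ εg τ κ ξg ξ ξp)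
    (measurableSet_qsassTrueEvent hφm hgm) hp.le hp1 hphat.2.le
    (fun k A hA => hrun.mul_le_measureReal_trueEvent hI hO₀ hO₁ hφm hgm
      (hnoise.imp id fun h => h.2) k hA) t
  have hsum := hrun.measureReal_noise_le hO₀ hφm hε0 hs (hnoise.imp (fun h => h.1) fun h => h.1) t
  have hcover : Set.univ ⊆ {ω | qsassStop I O₀ O₁ φ φstar ε ξg ξ ξp ω ≤ (t : ℕ∞)} ∪
      ({ω | ∑ k ∈ Finset.range t, (if ω ∈ qsassTrueEvent I O₀ O₁ φ εg τ κ ξg ξ ξp k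
          then (1 : ℝ) else 0) < phat * t} ∪
        {ω | t * (Real.log (1 + 4 * I.εf / ε) + s) < ∑ k ∈ Finset.range t,
          Real.log (1 + (2 * I.εf + (qsassErr I O₀ O₁ φ ξg ξ ξp k ω +
            qsassErrTrial I O₀ O₁ φ ξg ξ ξp k ω)) / ε)}) := by
    intro ω _
    by_contra hcon
    simp only [Set.mem_union, Set.mem_ofPred_eq, not_or, not_lt] at hcon
    obtain ⟨hlate, hcnt, hlog⟩ := hcon
    have hgap : ∀ k ≤ t, ε < φ (qsassState I O₀ O₁ ξg ξ ξp k ω).x - φstar := fun k hk =>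
      not_le.1 fun h => hlate (qsassStop_le_of_gap_le hk h)
    obtain ⟨j, -, hpot⟩ := hT.potential_le hI hdiff hLip hconv hstar hO₁.τ_nonneg hO₁.κ_nonneg
      hεf hε1 hε4 hi ω t hgap
    have hZ : 0 < Real.log ((φ (qsassState I O₀ O₁ ξg ξ ξp t ω).x - φstar) / ε) :=
      Real.log_pos ((one_lt_div hε0).2 (hgap t le_rfl))
    -- the grid distance of `αbar` from `α₀` is `|i|`
    have hdist : |-(Real.log I.α₀ - Real.log αbar) / (2 * Real.log I.γ)| = |(i : ℝ)| / 2 := by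
      have hlogγ : Real.log I.γ ≠ 0 := (Real.log_neg hI.γ_mem.1 hI.γ_mem.2).ne
      have h1 : -(Real.log I.α₀ - Real.log αbar) / (2 * Real.log I.γ) = (i : ℝ) / 2 := by
        rw [hi, Real.log_mul hI.α₀_pos.ne' (zpow_pos hI.γ_mem.1 i).ne', Real.log_zpow]
        field_simp
        ring
      rw [h1, abs_div, abs_of_pos (zero_lt_two (α := ℝ))]
    rw [hdist, ge_iff_le, div_le_iff₀ (sub_pos.2 hphat.1)] at ht
    have h1 := mul_le_mul_of_nonneg_left ht hh.le
    have h2 : I.h β τ η αbar * (1 / I.h β τ η αbar * Real.log ((φ I.x₀ - φstar) / ε) +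
        |(i : ℝ)| / 2) = Real.log ((φ I.x₀ - φstar) / ε) + I.h β τ η αbar * |(i : ℝ)| / 2 := by
      field_simp
    have h3 : I.h β τ η αbar * (t * (phat - pl)) = I.h β τ η αbar * (phat * t) -
        I.h β τ η αbar * t / 2 - t * (Real.log (1 + 4 * I.εf / ε) + s) := by
      rw [hpl]; field_simp; ring
    rw [h2, h3] at h1
    have h4 := mul_le_mul_of_nonneg_left hcnt hh.le
    have h5 : 0 ≤ I.h β τ η αbar * |(j : ℝ)| := by positivity
    linarith
  have hone := (measureReal_mono (μ := P) hcover).trans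
    ((measureReal_union_le _ _).trans (add_le_add le_rfl (measureReal_union_le _ _)))
  rw [probReal_univ] at hone
  have hexp : Real.exp (-(s * t)) ≤
      Real.exp (-(min (s ^ 2 * t / (2 * subexpParam I.εf ν b ε ^ 2))
        (s * t / (2 * subexpParam I.εf ν b ε)))) := by
    refine Real.exp_le_exp.2 (neg_le_neg ((min_le_right _ _).trans ?_))
    have h1 := four_le_subexpParam (b := b) hεf hO₀.ν_nonneg hε0
    exact div_le_self (by positivity) (by linarith)
  linarith
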